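/- Let $L>0$, $\gamma_0=\sqrt{2/L}$, $\lambda_n=n\pi/L$ and $\phi_n(x)=\gamma_0\sin(\lambda_n x)$ for $n\ge 1$. Let $a,\beta\in C^2([0,\infty))$ be real-valued with $a(0)>0$, and let $g\in C([0,\infty))$ be real-valued; put $f(t)=\int_0^t g(r)\,dr$ and $h(t)=g(t)+\int_0^t\beta(t-r)g(r)\,dr$. For $\xi\in L^2(0,L)$ and a continuous boundary temperature $F$, consider the Gurtin–Pipkin equation $$\frac{d}{dt}\Big[\theta(t)+\int_0^t\beta(t-s)\theta(s)\,ds\Big]=\int_0^t a(t-s)\,\theta_{xx}(s)\,ds\quad\text{on }(0,L),\qquad \theta(x,0)=\xi(x),\quad \theta(0,t)=F(t),\quad \theta(L,t)=0 .$$ A solution is a $\theta\in C([0,\infty);L^2(0,L))$ with $\theta(0)=\xi$ such that, for every $\varphi\in C^2$ with $\varphi(0)=\varphi(L)=0$ and every $t\ge 0$, $$\frac{d}{dt}\Big[\langle\theta(t),\varphi\rangle+\int_0^t\beta(t-s)\langle\theta(s),\varphi\rangle\,ds\Big]=\int_0^t a(t-s)\big(\langle\theta(s),\varphi''\rangle+F(s)\varphi'(0)\big)\,ds$$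 (one-sided derivative at $t=0$), where $\langle u,v\rangle=\int_0^L uv\,dx$. The flux at $x=L$ at time $t$ is $\lim_{x\to L^-}q(x,t)$, where $q(x,t)=-\partial_x\int_0^t a(t-s)\theta(x,s)\,ds$ (weak derivative in $x$, required to be an integrable function on $(0,L)$ with a representative for which the limit exists). Let $\theta_\xi$ be a solution with $F=0$ whose initial datum $\xi$ has the Fourier coefficients $\int_0^L\xi\,\phi_n\,dx=1/\lambda_n$, $n\ge 1$, and let $\theta^f$ be a solution with $\xi=0$ and $F=f$. Then for every $t\ge0$ the flux at $x=L$ of $\theta_\xi$, denoted $K(t)$, and that of $\theta^f$, denoted $Y^f(t)$, exist and are uniquely determined; $K$ is integrable on bounded intervals of $[0,\infty)$; and for all $t\ge 0$ $$Y^f(t)=\gamma_0\Big[\frac{\gamma_0}{2}\int_0^t a(s)\int_0^{t-s}g(r)\,dr\,ds-\int_0^t h(t-s)K(s)\,ds\Big].$$ Consequently $a$ is recovered from $\beta$, $g$, $K$ and $Y^f$ by solving a linear deconvolution problem: if $g$ is not identically zero, then $a$ is the only continuous function $b$ on $[0,\infty)$ such that $$\frac{\gamma_0^2}{2}\int_0^t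 b(s)\int_0^{t-s}g(r)\,dr\,ds=Y^f(t)+\gamma_0\int_0^t h(t-s)K(s)\,ds\qquad\text{for all }t\ge 0 .$$ -/

import Mathlib

open MeasureTheory Set Filter Topology

noncomputable section

namespace GurtinPipkin

/-- The real Hilbert space `L²(0, L)`. -/
abbrev L2 (L : ℝ) : Type := Lp ℝ 2 (volume.restrict (Ioo (0 : ℝ) L))

/-- Normalization constant `γ₀ = √(2 / L)` of the Dirichlet eigenfunctions on `(0, L)`. -/
def gamma0 (L : ℝ) : ℝ := Real.sqrt (2 / L)

/-- Frequencies `λₙ = n π / L`. -/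
def freq (L : ℝ) (n : ℕ) : ℝ := n * (Real.pi / L)

/-- Orthonormal Dirichlet eigenfunctions `φₙ(x) = γ₀ sin (λₙ x)`, `n ≥ 1`. -/
def eigenfun (L : ℝ) (n : ℕ) (x : ℝ) : ℝ := gamma0 L * Real.sin (freq L n * x)

/-- The pairing `∫₀ᴸ u(x) φ(x) dx`. -/
def pairing (L : ℝ) (u : L2 L) (φ : ℝ → ℝ) : ℝ := ∫ x in (0 : ℝ)..L, u x * φ x

/-- The primitive `∫₀ᵗ g(r) dr`. -/
def primitive (g : ℝ → ℝ) (t : ℝ) : ℝ := ∫ r in (0 : ℝ)..t, g r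

/-- `h = g + β ∗ g`. -/
def hfun (β g : ℝ → ℝ) (t : ℝ) : ℝ := g t + ∫ r in (0 : ℝ)..t, β (t - r) * g r

/-- `θ ∈ C([0, ∞); L²(0, L))` is the (weak) solution of
`d/dt [θ(t) + ∫₀ᵗ β(t-s) θ(s) ds] = ∫₀ᵗ a(t-s) θ_xx(s) ds` on `(0, L)`, with `θ(x, 0) = ξ(x)`,
`θ(0, t) = f(t)`, `θ(L, t) = 0`. The equation is tested with `C²` functions `φ` vanishing at `0` and
at `L`; integrating by parts twice in `x`, the boundary values of `θ` give
`⟨θ_xx, φ⟩ = ⟨θ, φ''⟩ + f φ'(0)`. -/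
structure IsSolution (L : ℝ) (a β f : ℝ → ℝ) (ξ : L2 L) (θ : ℝ → L2 L) : Prop where
  continuousOn : ContinuousOn θ (Ici 0)
  initial : θ 0 = ξ
  equation : ∀ φ : ℝ → ℝ, ContDiff ℝ 2 φ → φ 0 = 0 → φ L = 0 → ∀ t : ℝ, 0 ≤ t →
    HasDerivWithinAt
      (fun τ => pairing L (θ τ) φ + ∫ s in (0 : ℝ)..τ, β (τ - s) * pairing L (θ s) φ)
      (∫ s in (0 : ℝ)..t, a (t - s) * (pairing L (θ s) (deriv (deriv φ)) + f s * deriv φ 0))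
      (Ici 0) t

/-- `w(t) = ∫₀ᵗ a(t-s) θ(s) ds` as an element of `L²(0, L)`. -/
def relaxed (L : ℝ) (a : ℝ → ℝ) (θ : ℝ → L2 L) (t : ℝ) : L2 L :=
  ∫ s in (0 : ℝ)..t, a (t - s) • θ s

/-- `y` is the flux at `x = L` at time `t`: the density of the heat flux
`q(x, t) = -∂ₓ ∫₀ᵗ a(t-s) θ(x, s) ds` (a weak derivative in `x`) is an integrable function on
`(0, L)` and `q(x, t) → y` for `x → L⁻`. -/
def IsFluxAtRight (L : ℝ) (a : ℝ → ℝ) (θ : ℝ → L2 L) (t y : ℝ) : Prop :=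
  ∃ q : ℝ → ℝ, IntegrableOn q (Ioo 0 L) ∧
    (∃ c : ℝ, ∀ᵐ x ∂(volume.restrict (Ioo (0 : ℝ) L)),
      relaxed L a θ t x = c - ∫ x' in (0 : ℝ)..x, q x') ∧
    Tendsto q (𝓝[<] L) (𝓝 y)

/-- The right side of the flux identity, as an (affine) function of the kernel `b`:
`γ₀ [(γ₀/2) ∫₀ᵗ b(s) ∫₀^{t-s} g(r) dr ds - ∫₀ᵗ h(t-s) K(s) ds]`. -/
def fluxFormula (L : ℝ) (β g K b : ℝ → ℝ) (t : ℝ) : ℝ :=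
  gamma0 L * (gamma0 L / 2 * (∫ s in (0 : ℝ)..t, b s * ∫ r in (0 : ℝ)..(t - s), g r)
    - ∫ s in (0 : ℝ)..t, hfun β g (t - s) * K s)

end GurtinPipkin

end

open scoped NNReal

noncomputable section

/-! Write J for the constant function 1, so that convolution with J is integration, and let
juxtaposition denote convolution. Testing the equation with the eigenfunctions turns it into scalar
Volterra equations. If Z and Y are the n-th modes of the interior and of the boundary problem and μ
= λₙ, then (1 + β + μ²Ja)Z = J/μ and (1 + β + μ²Ja)Y = γ₀μ J a J g. Since 1 + N is injective for
every kernel N, algebra alone gives Y = γ₀(Jg/μ - hZ) (`mode_boundary_eq`). Convolved with a and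
multiplied by μ, this says that μ aY = γ₀(a J g - h (μ aZ)), where a J g does not depend on n. Read
as cosine coefficients, it makes γ₀(γ₀/2 · a J g - h q) a flux density for θ^f whenever q is a
zero-mean one for θ_ξ. Letting x → L⁻ gives the flux formula.

The analytic core is a q that is bounded, jointly measurable and has a left limit at L. Formally, in
Laplace variables, aZμ/a(0) equals 1/(P² + ω²) with ω = √a(0) μ and P = p + r + m̂(p), where m is a
kernel obtained from a square root in the convolution ring (`exists_sqrt`). As 1/(P² + ω²) = ∫
(e^{-sP}/P) cos(ωs) ds, the mode is the integral of cos(ωs) against a continuous kernel H(t, s) on 0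
≤ s ≤ t that does not depend on n (`exists_transmutation`). The wave speed is c = √a(0). Folding [0,
ct] onto [0, L] by finitely many reflections yields q (`exists_profile`), and completeness of the
sines identifies it as the weak derivative (`ae_eq_of_sine_coeffs`). Dominated convergence passes
the limit x → L⁻ through convolution with h.

For the recovery of a, two admissible kernels differ by a function whose convolution with the
primitive of g vanishes. Titchmarsh's theorem (`volterra_eq_zero`), proved with Phragmén-Lindelöf
and Liouville, forces the difference to be 0 unless g vanishes. -/

/-- Volterra convolution on the half line. -/
def volterra (f g : ℝ → ℝ) (t : ℝ) : ℝ := ∫ s in (0 : ℝ)..t, f (t - s) * g s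

/-! ### Fubini on a triangle and the algebra of Volterra convolution -/

theorem integral_triangle_swap_of_integrableOn {F : ℝ → ℝ → ℝ} {t : ℝ}
    (hF : IntegrableOn (Function.uncurry F) (Ioc 0 t ×ˢ Ioc 0 t) (volume.prod volume))
    (ht : 0 ≤ t) :
    ∫ τ in (0 : ℝ)..t, ∫ s in (0 : ℝ)..τ, F τ s = ∫ s in (0 : ℝ)..t, ∫ τ in s..t, F τ s := by
  let G : ℝ → ℝ → ℝ := fun τ s => ({p : ℝ × ℝ | p.2 ≤ p.1}.indicator (Function.uncurry F)) (τ, s)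
  have hmeas : MeasurableSet {p : ℝ × ℝ | p.2 ≤ p.1} :=
    measurableSet_le measurable_snd measurable_fst
  have hint : Integrable (Function.uncurry G)
      ((volume.restrict (Ioc 0 t)).prod (volume.restrict (Ioc 0 t))) := by
    rw [Measure.prod_restrict]
    exact hF.indicator hmeas
  have hsw := integral_integral_swap hint
  rw [intervalIntegral.integral_of_le ht, intervalIntegral.integral_of_le ht]
  calc _ = ∫ τ in Ioc 0 t, ∫ s in Ioc 0 t, G τ s := by
        refine setIntegral_congr_fun measurableSet_Ioc fun τ hτ => ?_
        have : ∀ s, G τ s = (Iic τ).indicator (fun s => F τ s) s := fun s => by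
          by_cases h : s ≤ τ <;> simp [G, h]
        simp only [this]
        rw [intervalIntegral.integral_of_le hτ.1.le, setIntegral_indicator measurableSet_Iic]
        congr 2
        ext s
        simp only [mem_Ioc, mem_inter_iff, mem_Iic] at hτ ⊢
        constructor
        · rintro ⟨h1, h2⟩; exact ⟨⟨h1, h2.trans hτ.2⟩, h2⟩
        · rintro ⟨h1, h2⟩; exact ⟨h1.1, h2⟩
    _ = ∫ s in Ioc 0 t, ∫ τ in Ioc 0 t, G τ s := hsw
    _ = _ := by
        refine setIntegral_congr_fun measurableSet_Ioc fun s hs => ?_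
        have : ∀ τ, G τ s = (Ici s).indicator (fun τ => F τ s) τ := fun τ => by
          by_cases h : s ≤ τ <;> simp [G, h]
        simp only [this]
        rw [intervalIntegral.integral_of_le hs.2, setIntegral_indicator measurableSet_Ici,
          ← integral_Icc_eq_integral_Ioc]
        congr 2
        ext τ
        simp only [mem_Ioc, mem_Icc, mem_inter_iff, mem_Ici] at hs ⊢
        constructor
        · rintro ⟨h1, h2⟩; exact ⟨h2, h1.2⟩
        · rintro ⟨h1, h2⟩; exact ⟨⟨hs.1.trans_le h1, h2⟩, h1⟩

theorem integral_triangle_swap {F : ℝ → ℝ → ℝ} (hF : Continuous (Function.uncurry F))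
    {t : ℝ} (ht : 0 ≤ t) :
    ∫ τ in (0 : ℝ)..t, ∫ s in (0 : ℝ)..τ, F τ s = ∫ s in (0 : ℝ)..t, ∫ τ in s..t, F τ s :=
  integral_triangle_swap_of_integrableOn
    ((hF.continuousOn.integrableOn_compact (isCompact_Icc.prod isCompact_Icc)).mono_set
      (prod_mono Ioc_subset_Icc_self Ioc_subset_Icc_self)) ht

theorem continuous_volterra {f g : ℝ → ℝ} (hf : Continuous f) (hg : Continuous g) :
    Continuous (volterra f g) :=
  intervalIntegral.continuous_parametric_intervalIntegral_of_continuous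
    (f := fun t s => f (t - s) * g s) (by fun_prop) continuous_id

theorem volterra_comm (f g : ℝ → ℝ) (t : ℝ) : volterra f g t = volterra g f t := by
  have := intervalIntegral.integral_comp_sub_left (fun s => f (t - s) * g s) t (a := 0) (b := t)
  simp only [sub_sub_cancel, sub_self, sub_zero] at this
  rw [volterra, volterra, ← this]
  exact intervalIntegral.integral_congr fun s _ => mul_comm _ _

theorem volterra_congr {f f' g g' : ℝ → ℝ} {t : ℝ} (ht : 0 ≤ t)
    (hf : ∀ s ∈ Icc 0 t, f s = f' s) (hg : ∀ s ∈ Icc 0 t, g s = g' s) :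
    volterra f g t = volterra f' g' t := by
  refine intervalIntegral.integral_congr fun s hs => ?_
  rw [uIcc_of_le ht] at hs
  rw [hf (t - s) ⟨by linarith [hs.2], by linarith [hs.1]⟩, hg s hs]

/-- A triangle swap followed by a translation. A profile Ψ constant in its first argument gives
associativity; the general case lets convolution act under the integral in `wave`. -/
theorem volterra_integral {f h : ℝ → ℝ} {Ψ : ℝ → ℝ → ℝ} (hf : Continuous f) (hh : Continuous h)
    (hΨ : Continuous (Function.uncurry Ψ)) {t : ℝ} (ht : 0 ≤ t) :
    volterra f (fun τ => ∫ s in (0 : ℝ)..τ, Ψ s (τ - s) * h s) t =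
      ∫ s in (0 : ℝ)..t, volterra f (Ψ s) (t - s) * h s := by
  have hc : Continuous (Function.uncurry fun τ s => f (t - τ) * (Ψ s (τ - s) * h s)) := by
    have : Continuous fun p : ℝ × ℝ => Ψ p.2 (p.1 - p.2) :=
      hΨ.comp (by fun_prop : Continuous fun p : ℝ × ℝ => (p.2, p.1 - p.2))
    simp only [Function.uncurry_def]
    fun_prop
  have := integral_triangle_swap hc ht
  simp only [volterra, ← intervalIntegral.integral_const_mul]
  rw [this]
  refine intervalIntegral.integral_congr fun s _ => ?_
  rw [← intervalIntegral.integral_mul_const]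
  have h2 := intervalIntegral.integral_comp_sub_right
    (fun u => f (t - s - u) * Ψ s u * h s) s (a := s) (b := t)
  simp only [sub_self] at h2
  rw [← h2]
  refine intervalIntegral.integral_congr fun τ _ => ?_
  rw [show t - s - (τ - s) = t - τ by ring, mul_assoc]

theorem volterra_assoc {f g h : ℝ → ℝ} (hf : Continuous f) (hg : Continuous g)
    (hh : Continuous h) {t : ℝ} (ht : 0 ≤ t) :
    volterra (volterra f g) h t = volterra f (volterra g h) t :=
  (volterra_integral (Ψ := fun _ => g) hf hh
    (hg.comp continuous_snd) ht).symm

theorem volterra_one (f : ℝ → ℝ) (t : ℝ) : volterra f (fun _ => 1) t = ∫ s in (0 : ℝ)..t, f s := by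
  rw [volterra_comm]; simp [volterra]

theorem volterra_add_right {f g h : ℝ → ℝ} (hf : Continuous f) (hg : Continuous g)
    (hh : Continuous h) (t : ℝ) :
    volterra f (fun s => g s + h s) t = volterra f g t + volterra f h t := by
  simp only [volterra, mul_add]
  exact intervalIntegral.integral_add
    ((by fun_prop : Continuous fun s => f (t - s) * g s).intervalIntegrable _ _)
    ((by fun_prop : Continuous fun s => f (t - s) * h s).intervalIntegrable _ _)

theorem volterra_smul_right (f g : ℝ → ℝ) (r t : ℝ) :
    volterra f (fun s => r * g s) t = r * volterra f g t := by
  simp only [volterra, mul_left_comm]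
  exact intervalIntegral.integral_const_mul _ _

theorem abs_volterra_le {f g : ℝ → ℝ} {t A B : ℝ} (ht : 0 ≤ t)
    (hf : ∀ s ∈ Icc 0 t, |f s| ≤ A) (hg : ∀ s ∈ Icc 0 t, |g s| ≤ B) (hA : 0 ≤ A) :
    |volterra f g t| ≤ A * B * t := by
  have := intervalIntegral.norm_integral_le_of_norm_le_const (a := 0) (b := t) (C := A * B)
    (f := fun s => f (t - s) * g s) ?_
  · simpa [volterra, abs_of_nonneg ht] using this
  · intro s hs
    rw [uIoc_of_le ht] at hs
    rw [norm_mul]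
    exact mul_le_mul (hf _ ⟨by linarith [hs.2], by linarith [hs.1]⟩) (hg _ ⟨hs.1.le, hs.2⟩)
      (norm_nonneg _) hA

/-! ### The convolution ring of a bounded interval and its quadratic equations -/

/-- Continuous functions on `[0, T]`, multiplied by Volterra convolution. -/
def Kernel (T : ℝ≥0) : Type := C(Icc (0 : ℝ) T, ℝ)

namespace Kernel

variable {T : ℝ≥0}

instance : NormedAddCommGroup (Kernel T) := inferInstanceAs (NormedAddCommGroup C(Icc (0 : ℝ) T, ℝ))
instance : NormedSpace ℝ (Kernel T) := inferInstanceAs (NormedSpace ℝ C(Icc (0 : ℝ) T, ℝ))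
instance : CompleteSpace (Kernel T) := inferInstanceAs (CompleteSpace C(Icc (0 : ℝ) T, ℝ))

/-- The underlying continuous map. -/
def toMap (f : Kernel T) : C(Icc (0 : ℝ) T, ℝ) := f

/-- The extension of a kernel to the line, constant outside `[0, T]`. -/
def ext (f : Kernel T) : ℝ → ℝ := IccExtend T.coe_nonneg f.toMap

/-- The restriction of a continuous function to `[0, T]`. -/
def ofFun (T : ℝ≥0) (f : ℝ → ℝ) (hf : Continuous f) : Kernel T :=
  (⟨fun x => f x, hf.comp continuous_subtype_val⟩ : C(Icc (0 : ℝ) T, ℝ))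

theorem continuous_ext (f : Kernel T) : Continuous f.ext :=
  Continuous.Icc_extend' (ContinuousMap.continuous _)

theorem ext_ofFun {f : ℝ → ℝ} (hf : Continuous f) {t : ℝ} (ht : t ∈ Icc (0 : ℝ) T) :
    (ofFun T f hf).ext t = f t :=
  IccExtend_of_mem T.coe_nonneg (ofFun T f hf).toMap ht

theorem ext_coe (f : Kernel T) (x : Icc (0 : ℝ) T) : f.ext x = f.toMap x :=
  IccExtend_of_mem T.coe_nonneg f.toMap x.2

theorem eq_of_ext {f g : Kernel T} (h : ∀ t ∈ Icc (0 : ℝ) T, f.ext t = g.ext t) : f = g :=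
  ContinuousMap.ext (f := f.toMap) (g := g.toMap) fun x => by
    rw [← ext_coe, h x x.2, ext_coe]

theorem ext_add (f g : Kernel T) (t : ℝ) : (f + g).ext t = f.ext t + g.ext t := rfl
theorem ext_sub (f g : Kernel T) (t : ℝ) : (f - g).ext t = f.ext t - g.ext t := rfl
theorem ext_neg (f : Kernel T) (t : ℝ) : (-f).ext t = -f.ext t := rfl
theorem ext_smul (r : ℝ) (f : Kernel T) (t : ℝ) : (r • f).ext t = r * f.ext t := rfl
theorem ext_zero (t : ℝ) : (0 : Kernel T).ext t = 0 := rfl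

theorem abs_ext_le (f : Kernel T) (t : ℝ) : |f.ext t| ≤ ‖f‖ :=
  ContinuousMap.norm_coe_le_norm f.toMap (projIcc 0 _ T.coe_nonneg t)

theorem norm_le_of {f : Kernel T} {C : ℝ} (hC : 0 ≤ C) (h : ∀ t ∈ Icc (0 : ℝ) T, |f.ext t| ≤ C) :
    ‖f‖ ≤ C :=
  (ContinuousMap.norm_le f.toMap hC).2 fun x => by
    rw [← ext_coe]
    exact h x x.2

theorem continuous_ext_uncurry {X : Type*} [TopologicalSpace X] {F : X → Kernel T}
    (hF : Continuous F) {τ : X → ℝ} (hτ : Continuous τ) : Continuous fun x => (F x).ext (τ x) := by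
  have h1 : Continuous fun x => (projIcc 0 (T : ℝ) T.coe_nonneg) (τ x) := continuous_projIcc.comp hτ
  exact (ContinuousEval.continuous_eval (F := C(Icc (0 : ℝ) T, ℝ))).comp
    ((show Continuous (fun x => (F x).toMap) from hF).prodMk h1)

instance : Mul (Kernel T) := ⟨fun f g => ofFun T (volterra f.ext g.ext)
  (continuous_volterra f.continuous_ext g.continuous_ext)⟩

theorem ext_mul (f g : Kernel T) {t : ℝ} (ht : t ∈ Icc (0 : ℝ) T) :
    (f * g).ext t = volterra f.ext g.ext t := ext_ofFun _ ht

theorem ext_mul_mul (f g h : Kernel T) {t : ℝ} (ht : t ∈ Icc (0 : ℝ) T) :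
    (f * (g * h)).ext t = volterra f.ext (volterra g.ext h.ext) t := by
  rw [ext_mul _ _ ht]
  exact volterra_congr ht.1 (fun _ _ => rfl) fun s hs => ext_mul _ _ ⟨hs.1, hs.2.trans ht.2⟩

protected theorem mul_comm' (f g : Kernel T) : f * g = g * f :=
  eq_of_ext fun t ht => by rw [ext_mul _ _ ht, ext_mul _ _ ht, volterra_comm]

protected theorem mul_add' (f g h : Kernel T) : f * (g + h) = f * g + f * h :=
  eq_of_ext fun t ht => by
    rw [ext_add, ext_mul _ _ ht, ext_mul _ _ ht, ext_mul _ _ ht]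
    exact volterra_add_right f.continuous_ext g.continuous_ext h.continuous_ext t

protected theorem mul_smul' (r : ℝ) (f g : Kernel T) : f * (r • g) = r • (f * g) :=
  eq_of_ext fun t ht => by
    rw [ext_smul, ext_mul _ _ ht, ext_mul _ _ ht]
    exact volterra_smul_right f.ext g.ext r t

instance : NonUnitalCommRing (Kernel T) where
  left_distrib := Kernel.mul_add'
  right_distrib f g h := by
    rw [Kernel.mul_comm', Kernel.mul_add', Kernel.mul_comm' h, Kernel.mul_comm' h]
  zero_mul f := by
    rw [Kernel.mul_comm']
    simpa using Kernel.mul_smul' (T := T) 0 f 0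
  mul_zero f := by simpa using Kernel.mul_smul' (T := T) 0 f 0
  mul_assoc f g h := by
    refine eq_of_ext fun t ht => ?_
    rw [ext_mul_mul _ _ _ ht, ← volterra_assoc f.continuous_ext g.continuous_ext h.continuous_ext
      ht.1, ext_mul _ _ ht]
    exact volterra_congr ht.1 (fun s hs => ext_mul _ _ ⟨hs.1, hs.2.trans ht.2⟩) fun _ _ => rfl
  mul_comm := Kernel.mul_comm'

instance : SMulCommClass ℝ (Kernel T) (Kernel T) where
  smul_comm r f g := (Kernel.mul_smul' r f g).symm

instance : IsScalarTower ℝ (Kernel T) (Kernel T) where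
  smul_assoc r f g := by
    simp only [smul_eq_mul]
    rw [mul_comm, Kernel.mul_smul', mul_comm g f]

theorem norm_mul_le' (f g : Kernel T) : ‖f * g‖ ≤ ‖f‖ * ‖g‖ * T :=
  norm_le_of (by positivity) fun t ht => by
    rw [ext_mul _ _ ht]
    refine (abs_volterra_le ht.1 (fun s _ => f.abs_ext_le s) (fun s _ => g.abs_ext_le s)
      (norm_nonneg _)).trans ?_
    exact mul_le_mul_of_nonneg_left ht.2 (by positivity)

/-- Multiplication by `e^{-κ t}`. -/
def weight (κ : ℝ) (f : Kernel T) : Kernel T :=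
  ofFun T (fun t => Real.exp (-κ * t) * f.ext t) (by have := f.continuous_ext; fun_prop)

theorem ext_weight (κ : ℝ) (f : Kernel T) {t : ℝ} (ht : t ∈ Icc (0 : ℝ) T) :
    (weight κ f).ext t = Real.exp (-κ * t) * f.ext t := ext_ofFun _ ht

/-- The exponential splits along t = (t - s) + s, so weighting respects convolution and equations
can be solved after weighting. -/
theorem weight_mul (κ : ℝ) (f g : Kernel T) : weight κ (f * g) = weight κ f * weight κ g :=
  eq_of_ext fun t ht => by
    rw [ext_weight _ _ ht, ext_mul _ _ ht, ext_mul _ _ ht, volterra, volterra,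
      ← intervalIntegral.integral_const_mul]
    refine intervalIntegral.integral_congr fun s hs => ?_
    rw [uIcc_of_le ht.1] at hs
    rw [ext_weight _ _ ⟨hs.1, hs.2.trans ht.2⟩,
      ext_weight _ _ ⟨by linarith [hs.2], by linarith [hs.1, ht.2]⟩,
      show -κ * t = -κ * (t - s) + -κ * s by ring, Real.exp_add]
    ring

theorem weight_add (κ : ℝ) (f g : Kernel T) : weight κ (f + g) = weight κ f + weight κ g :=
  eq_of_ext fun t ht => by
    rw [ext_add, ext_weight _ _ ht, ext_weight _ _ ht, ext_weight _ _ ht, ext_add, mul_add]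

theorem weight_weight_neg (κ : ℝ) (f : Kernel T) : weight (-κ) (weight κ f) = f :=
  eq_of_ext fun t ht => by
    rw [ext_weight _ _ ht, ext_weight _ _ ht, ← mul_assoc, ← Real.exp_add]
    simp

theorem norm_weight_le {κ : ℝ} (hκ : 0 ≤ κ) (f : Kernel T) : ‖weight κ f‖ ≤ ‖f‖ :=
  norm_le_of (norm_nonneg _) fun t ht => by
    rw [ext_weight _ _ ht, abs_mul, Real.abs_exp]
    refine (mul_le_of_le_one_left (abs_nonneg _) ?_).trans (f.abs_ext_le t)
    exact Real.exp_le_one_iff.2 (by nlinarith [ht.1])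

/-- The integral of e^{-κs} is at most 1/κ, so a large κ makes convolution with a weighted kernel
small, however long the interval. -/
theorem norm_weight_mul_le {κ : ℝ} (hκ : 0 < κ) (f g : Kernel T) :
    ‖weight κ f * g‖ ≤ ‖f‖ / κ * ‖g‖ :=
  norm_le_of (by positivity) fun t ht => by
    rw [ext_mul _ _ ht, volterra_comm, volterra]
    have h1 : ∀ s ∈ Icc 0 t, ‖g.ext (t - s) * (weight κ f).ext s‖
        ≤ ‖f‖ * ‖g‖ * Real.exp (-κ * s) := fun s hs => by
      rw [ext_weight _ _ ⟨hs.1, hs.2.trans ht.2⟩, norm_mul, norm_mul, Real.norm_eq_abs,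
        Real.norm_eq_abs, Real.norm_eq_abs, Real.abs_exp]
      have h2 := mul_le_mul (g.abs_ext_le (t - s)) (f.abs_ext_le s) (abs_nonneg _) (norm_nonneg _)
      nlinarith [Real.exp_pos (-κ * s)]
    have h3 : IntervalIntegrable (fun s => ‖f‖ * ‖g‖ * Real.exp (-κ * s)) volume 0 t :=
      (by fun_prop : Continuous fun s => ‖f‖ * ‖g‖ * Real.exp (-κ * s)).intervalIntegrable _ _
    have h4 := intervalIntegral.norm_integral_le_of_norm_le ht.1
      (Eventually.of_forall fun s hs => h1 s (Ioc_subset_Icc_self hs)) h3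
    rw [Real.norm_eq_abs] at h4
    refine h4.trans ?_
    have h5 : ∀ s ∈ uIcc 0 t,
        HasDerivAt (fun s => -(Real.exp (-κ * s) / κ)) (Real.exp (-κ * s)) s := fun s _ => by
      have : HasDerivAt (fun s : ℝ => -κ * s) (-κ) s := by
        simpa using (hasDerivAt_id s).const_mul (-κ)
      convert! (this.exp.div_const κ).neg using 1
      field_simp
    rw [intervalIntegral.integral_const_mul, intervalIntegral.integral_eq_sub_of_hasDerivAt h5
      ((by fun_prop : Continuous fun s => Real.exp (-κ * s)).intervalIntegrable _ _)]
    have h6 : -(Real.exp (-κ * t) / κ) - -(Real.exp (-κ * 0) / κ) ≤ 1 / κ := by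
      simp only [mul_zero, Real.exp_zero]
      have : 0 ≤ Real.exp (-κ * t) / κ := by positivity
      linarith
    calc _ ≤ ‖f‖ * ‖g‖ * (1 / κ) := mul_le_mul_of_nonneg_left h6 (by positivity)
      _ = _ := by ring

/-- After weighting, the right-hand side is a contraction of a fixed ball for large κ, so a solution
exists on all of [0, T] in spite of the quadratic term. -/
theorem exists_quadratic_volterra (b A C : Kernel T) : ∃ m : Kernel T, m = b + A * m + C * (m * m) := by
  set R := ‖b‖ + 1 with hR
  have hR0 : 0 < R := by positivity
  set D := ‖A‖ * R + ‖C‖ * (R * R * T) + ‖A‖ + ‖C‖ * (2 * R * T) with hD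
  have hD0 : 0 ≤ D := by positivity
  -- D adds the constants of both estimates, the size on the ball and the Lipschitz constant; this κ
  -- gives D/κ ≤ 1/2, which serves for both.
  set κ := 2 * D + 1 with hκ
  have hκ0 : 0 < κ := by positivity
  let F : Kernel T → Kernel T := fun n => weight κ b + weight κ A * n + weight κ C * (n * n)
  suffices ∃ n, F n = n by
    obtain ⟨n, hn⟩ := this
    refine ⟨weight (-κ) n, ?_⟩
    conv_lhs => rw [← hn]
    simp only [F, weight_add, weight_mul, weight_weight_neg]
  have hDκ : D / κ ≤ 1 / 2 := by
    rw [div_le_div_iff₀ hκ0 two_pos]; linarith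
  have hsq : ∀ n ∈ Metric.closedBall (0 : Kernel T) R, ‖n * n‖ ≤ R * R * T := fun n hn => by
    rw [mem_closedBall_zero_iff] at hn
    exact (norm_mul_le' n n).trans (by gcongr)
  have hmaps : MapsTo F (Metric.closedBall 0 R) (Metric.closedBall 0 R) := fun n hn => by
    have h2 := hsq n hn
    rw [mem_closedBall_zero_iff] at hn ⊢
    calc ‖F n‖ ≤ ‖weight κ b‖ + ‖weight κ A * n‖ + ‖weight κ C * (n * n)‖ := norm_add₃_le
      _ ≤ ‖b‖ + ‖A‖ / κ * R + ‖C‖ / κ * (R * R * T) := by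
        gcongr
        · exact norm_weight_le hκ0.le b
        · exact (norm_weight_mul_le hκ0 A n).trans (by gcongr)
        · exact (norm_weight_mul_le hκ0 C _).trans (by gcongr)
      _ = ‖b‖ + (‖A‖ * R + ‖C‖ * (R * R * T)) / κ := by ring
      _ ≤ ‖b‖ + D / κ := by
        gcongr
        have : 0 ≤ ‖A‖ + ‖C‖ * (2 * R * T) := by positivity
        linarith
      _ ≤ R := by linarith
  have hlip : ∀ n ∈ Metric.closedBall (0 : Kernel T) R, ∀ n' ∈ Metric.closedBall (0 : Kernel T) R,
      dist (F n) (F n') ≤ 1 / 2 * dist n n' := fun n hn n' hn' => by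
    rw [mem_closedBall_zero_iff] at hn hn'
    have e : F n - F n' = weight κ A * (n - n') + weight κ C * ((n + n') * (n - n')) := by
      simp only [F, mul_sub, add_mul, mul_add, mul_comm n' n]; abel
    have hs : ‖n + n'‖ ≤ 2 * R := (norm_add_le _ _).trans (by linarith)
    rw [dist_eq_norm, dist_eq_norm, e]
    calc _ ≤ ‖weight κ A * (n - n')‖ + ‖weight κ C * ((n + n') * (n - n'))‖ := norm_add_le _ _
      _ ≤ ‖A‖ / κ * ‖n - n'‖ + ‖C‖ / κ * (2 * R * ‖n - n'‖ * T) := by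
        gcongr
        · exact norm_weight_mul_le hκ0 A _
        · exact (norm_weight_mul_le hκ0 C _).trans
            (by gcongr; exact (norm_mul_le' _ _).trans (by gcongr))
      _ = (‖A‖ + ‖C‖ * (2 * R * T)) / κ * ‖n - n'‖ := by ring
      _ ≤ D / κ * ‖n - n'‖ := by
        gcongr
        have : 0 ≤ ‖A‖ * R + ‖C‖ * (R * R * T) := by positivity
        linarith
      _ ≤ 1 / 2 * ‖n - n'‖ := by gcongr
  have hc : ContractingWith (1 / 2 : ℝ≥0) (hmaps.restrict F _ _) := by
    refine ⟨by rw [← NNReal.coe_lt_coe]; norm_num, LipschitzWith.of_dist_le_mul fun x y => ?_⟩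
    have := hlip x x.2 y y.2
    simp only [NNReal.coe_div, NNReal.coe_one, NNReal.coe_ofNat]
    exact this
  obtain ⟨n, -, hn, -⟩ := ContractingWith.exists_fixedPoint' (Metric.isClosed_closedBall.isComplete)
    hmaps hc (x := 0) (by simp [hR0.le]) (edist_ne_top _ _)
  exact ⟨n, hn⟩

theorem eq_zero_of_add_mul_eq_zero {d N : Kernel T} (h : d + N * d = 0) : d = 0 := by
  -- The resolvent: (1 + N)(1 + r) = 1 once a unit is adjoined.
  obtain ⟨r, hr⟩ := exists_quadratic_volterra (-N) (-N) 0
  have h1 : r * d + N * (r * d) = -(N * d) := by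
    conv_lhs => enter [1]; rw [hr]
    simp only [zero_mul, add_zero, add_mul, neg_mul, mul_assoc]
    abel
  have h2 : r * d + N * (r * d) = 0 := by
    rw [mul_left_comm, ← mul_add, h, mul_zero]
  rw [h1, neg_eq_zero] at h2
  rwa [h2, add_zero] at h

end Kernel

/-! ### Convolution semigroups and the transmutation to cosines -/

namespace Kernel

variable {T : ℝ≥0}

/-- The unit constant function, whose convolution is integration. -/
def unit (T : ℝ≥0) : Kernel T := ofFun T (fun _ => 1) continuous_const

theorem ext_unit {t : ℝ} (ht : t ∈ Icc (0 : ℝ) T) : (unit T).ext t = 1 := ext_ofFun _ ht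

theorem ext_unit_mul (f : Kernel T) {t : ℝ} (ht : t ∈ Icc (0 : ℝ) T) :
    (unit T * f).ext t = ∫ s in (0 : ℝ)..t, f.ext s := by
  rw [mul_comm, ext_mul _ _ ht, ← volterra_one]
  exact volterra_congr ht.1 (fun _ _ => rfl) fun s hs => ext_unit ⟨hs.1, hs.2.trans ht.2⟩

/-- Convolution with a kernel as a bounded operator. -/
def mulCLM (f : Kernel T) : Kernel T →L[ℝ] Kernel T :=
  LinearMap.mkContinuous
    { toFun := fun g => f * g
      map_add' := fun g h => mul_add f g h
      map_smul' := fun r g => mul_smul_comm r f g } (‖f‖ * T)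
    fun g => (norm_mul_le' f g).trans_eq (by ring)

theorem mulCLM_apply (f g : Kernel T) : mulCLM f g = f * g := rfl

/-- The operator `g ↦ r g + m * g`. -/
def gen (r : ℝ) (m : Kernel T) : Kernel T →L[ℝ] Kernel T := r • 1 + mulCLM m

theorem gen_apply (r : ℝ) (m g : Kernel T) : gen r m g = r • g + m * g := rfl

/-- The group `e^{-s (r + m *)}` applied to a kernel. -/
def flow (r : ℝ) (m φ : Kernel T) (s : ℝ) : Kernel T := NormedSpace.exp (s • (-gen r m)) φ

theorem flow_zero (r : ℝ) (m φ : Kernel T) : flow r m φ 0 = φ := by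
  simp [flow]

/-- Convolution operators commute, hence they commute with the exponential of the generator. -/
theorem mul_flow (r : ℝ) (m f φ : Kernel T) (s : ℝ) : f * flow r m φ s = flow r m (f * φ) s := by
  have h : Commute (mulCLM f) (s • (-gen r m)) := by
    refine Commute.smul_right (Commute.neg_right ?_) s
    ext1 g
    simp only [mul_apply_eq_comp, mulCLM_apply, gen_apply, mul_add, mul_smul_comm,
      mul_left_comm f m g]
  exact congrArg (fun A : Kernel T →L[ℝ] Kernel T => A φ) h.exp_right.eq

theorem flow_add (r : ℝ) (m φ ψ : Kernel T) (s : ℝ) :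
    flow r m (φ + ψ) s = flow r m φ s + flow r m ψ s := map_add _ _ _

theorem hasDerivAt_flow (r : ℝ) (m φ : Kernel T) (s : ℝ) :
    HasDerivAt (flow r m φ) (-flow r m (r • φ + m * φ) s) s := by
  have h := (hasDerivAt_exp_smul_const (𝕂 := ℝ) (-gen r m) s).clm_apply (hasDerivAt_const s φ)
  convert! h using 1
  simp [flow, gen_apply]

theorem continuous_flow (r : ℝ) (m φ : Kernel T) : Continuous (flow r m φ) :=
  continuous_iff_continuousAt.2 fun s => (hasDerivAt_flow r m φ s).continuousAt

theorem continuous_flow_ext (r : ℝ) (m φ : Kernel T) :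
    Continuous (Function.uncurry fun s τ => (flow r m φ s).ext τ) :=
  continuous_ext_uncurry ((continuous_flow r m φ).comp continuous_fst) continuous_snd

/-- A chain rule along the characteristic s ↦ (s, t - s). The derivative of Ψ is taken in the sup
norm, so its remainder is uniform in the moving argument; differentiability in that argument comes
from Ψ s being a primitive. -/
theorem hasDerivAt_ext_diag {Ψ : ℝ → Kernel T} {Ψ' u : Kernel T} {t s : ℝ}
    (hΨ : HasDerivAt Ψ Ψ' s) (hu : Ψ s = unit T * u) (hs : t - s ∈ Ioo (0 : ℝ) T) :
    HasDerivAt (fun s => (Ψ s).ext (t - s)) (Ψ'.ext (t - s) - u.ext (t - s)) s := by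
  have h3 : HasDerivAt (fun x => (Ψ s).ext (t - x)) (-u.ext (t - s)) s := by
    have h1 : HasDerivAt (fun τ => ∫ x in (0 : ℝ)..τ, u.ext x) (u.ext (t - s)) (t - s) :=
      intervalIntegral.integral_hasDerivAt_right (u.continuous_ext.intervalIntegrable _ _)
        (u.continuous_ext.stronglyMeasurableAtFilter _ _) u.continuous_ext.continuousAt
    have h2 : HasDerivAt (Ψ s).ext (u.ext (t - s)) (t - s) := by
      refine h1.congr_of_eventuallyEq ?_
      filter_upwards [Icc_mem_nhds hs.1 hs.2] with τ hτ
      rw [hu, ext_unit_mul _ hτ]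
    have := h2.comp s ((hasDerivAt_id s).const_sub t)
    convert! this using 1
    simp
  rw [hasDerivAt_iff_isLittleO] at hΨ h3 ⊢
  have h1 : (fun x => (Ψ x - Ψ s - (x - s) • Ψ').ext (t - x)) =o[𝓝 s] fun x => x - s :=
    (Asymptotics.IsBigO.of_bound 1 (Eventually.of_forall fun x => by
      rw [one_mul]
      exact abs_ext_le (Ψ x - Ψ s - (x - s) • Ψ') (t - x))).trans_isLittleO hΨ
  have h2 : (fun x => (x - s) * (Ψ'.ext (t - x) - Ψ'.ext (t - s))) =o[𝓝 s] fun x => x - s := by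
    have hc : Continuous fun x => Ψ'.ext (t - x) - Ψ'.ext (t - s) := by
      have := Ψ'.continuous_ext; fun_prop
    have : (fun x => Ψ'.ext (t - x) - Ψ'.ext (t - s)) =o[𝓝 s] fun _ => (1 : ℝ) := by
      rw [Asymptotics.isLittleO_one_iff]
      simpa using hc.tendsto s
    simpa using (Asymptotics.isBigO_refl (fun x => x - s) (𝓝 s)).mul_isLittleO this
  refine ((h1.add h2).add h3).congr_left fun x => ?_
  simp only [ext_sub, ext_smul, smul_eq_mul]
  ring

/-- `t ↦ ∫₀ᵗ (e^{-s(r + m*)} φ)(t - s) κ(s) ds`. -/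
def wave (r : ℝ) (m φ : Kernel T) (κ : ℝ → ℝ) (hκ : Continuous κ) : Kernel T :=
  ofFun T (fun t => ∫ s in (0 : ℝ)..t, (flow r m φ s).ext (t - s) * κ s)
    (intervalIntegral.continuous_parametric_intervalIntegral_of_continuous
      (f := fun t s => (flow r m φ s).ext (t - s) * κ s)
      (((continuous_flow_ext r m φ).comp
        (by fun_prop : Continuous fun p : ℝ × ℝ => (p.2, p.1 - p.2))).mul
        (hκ.comp continuous_snd)) continuous_id)

theorem ext_wave (r : ℝ) (m φ : Kernel T) {κ : ℝ → ℝ} (hκ : Continuous κ) {t : ℝ}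
    (ht : t ∈ Icc (0 : ℝ) T) :
    (wave r m φ κ hκ).ext t = ∫ s in (0 : ℝ)..t, (flow r m φ s).ext (t - s) * κ s :=
  ext_ofFun _ ht

theorem mul_wave (r : ℝ) (m f φ : Kernel T) {κ : ℝ → ℝ} (hκ : Continuous κ) :
    f * wave r m φ κ hκ = wave r m (f * φ) κ hκ :=
  eq_of_ext fun t ht => by
    rw [ext_mul _ _ ht, ext_wave _ _ _ _ ht, volterra_congr ht.1 (fun _ _ => rfl)
      (fun s hs => ext_wave r m φ hκ ⟨hs.1, hs.2.trans ht.2⟩),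
      volterra_integral f.continuous_ext hκ (continuous_flow_ext r m φ) ht.1]
    refine intervalIntegral.integral_congr fun s hs => ?_
    rw [uIcc_of_le ht.1] at hs
    rw [← mul_flow, ext_mul _ _ ⟨by linarith [hs.2], by linarith [hs.1, ht.2]⟩]

/-- In Laplace variables this is ∫ e^{-sP} P κ ds = κ(0) + ∫ e^{-sP} κ' ds with P = p + r + m̂,
multiplied by J = 1/p so that only kernels occur: JP = 1 + rJ + Jm. -/
theorem wave_by_parts (r : ℝ) (m φ : Kernel T) {κ κ' : ℝ → ℝ} (hκ : Continuous κ)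
    (hκ' : Continuous κ') (hd : ∀ s, HasDerivAt κ (κ' s) s) :
    wave r m (φ + (r • unit T + unit T * m) * φ) κ hκ =
      κ 0 • (unit T * φ) + wave r m (unit T * φ) κ' hκ' :=
  eq_of_ext fun t ht => by
    rw [ext_add, ext_smul, ext_wave _ _ _ _ ht, ext_wave _ _ _ _ ht]
    have hcont : ∀ ψ : Kernel T, Continuous fun s => (flow r m ψ s).ext (t - s) := fun ψ =>
      (continuous_flow_ext r m ψ).comp (by fun_prop : Continuous fun s : ℝ => (s, t - s))
    set P := φ + (r • unit T + unit T * m) * φ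
    have hder : ∀ s ∈ Ioo 0 t, HasDerivAt (fun s => (flow r m (unit T * φ) s).ext (t - s))
        (-(flow r m P s).ext (t - s)) s := fun s hs => by
      have := hasDerivAt_ext_diag (hasDerivAt_flow r m (unit T * φ) s) (u := flow r m φ s)
        (mul_flow _ _ _ _ _).symm (t := t) ⟨by linarith [hs.2], by linarith [hs.1, ht.2]⟩
      convert! this using 1
      have e : P = φ + (r • (unit T * φ) + m * (unit T * φ)) := by
        simp only [P, add_mul, smul_mul_assoc, mul_assoc, mul_left_comm m]
      rw [e, flow_add, ext_add, ext_neg]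
      ring
    have h := intervalIntegral.integral_eq_sub_of_hasDerivAt_of_le ht.1
      ((hcont (unit T * φ)).mul hκ).continuousOn
      (fun s hs => (hder s hs).mul (hd s))
      (by
        have h1 := hcont P
        have h2 := hcont (unit T * φ)
        exact (by fun_prop : Continuous fun s => -(flow r m P s).ext (t - s) * κ s
          + (flow r m (unit T * φ) s).ext (t - s) * κ' s).intervalIntegrable _ _)
    have h1 := hcont P
    have h2 := hcont (unit T * φ)
    rw [intervalIntegral.integral_add
      ((by fun_prop : Continuous fun s => -(flow r m P s).ext (t - s) * κ s).intervalIntegrable _ _)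
      ((by fun_prop : Continuous fun s =>
        (flow r m (unit T * φ) s).ext (t - s) * κ' s).intervalIntegrable _ _)] at h
    simp only [neg_mul, intervalIntegral.integral_neg, sub_self, sub_zero, flow_zero,
      Pi.mul_apply] at h
    rw [← mul_flow, ext_unit_mul _ ⟨le_rfl, T.coe_nonneg⟩, intervalIntegral.integral_same] at h
    linarith

/-- Turns scalars into ring elements, so that kernel identities become polynomial identities in a
commutative ring with unit, within reach of `linear_combination`. -/
theorem inr_smul' (r : ℝ) (f : Kernel T) : ((r • f : Kernel T) : Unitization ℝ (Kernel T)) =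
    algebraMap ℝ (Unitization ℝ (Kernel T)) r * f :=
  (Unitization.inl_mul_inr r f).symm

/-- Every term of the expanded identity contains a factor J. Dividing it out leaves the scalar
condition 2r = β₀ - α₀ and a quadratic Volterra equation for m. -/
theorem exists_sqrt (α₀ β₀ : ℝ) (α₁ β₁ : Kernel T) :
    ∃ (r : ℝ) (m : Kernel T),
      (1 + (↑(α₀ • unit T + unit T * α₁) : Unitization ℝ (Kernel T))) *
        (1 + ↑(r • unit T + unit T * m)) ^ 2 = 1 + ↑(β₀ • unit T + unit T * β₁) := by
  set α := α₀ • unit T + unit T * α₁ with hα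
  set r := (β₀ - α₀) / 2 with hr
  set q := unit T + α * unit T with hq
  obtain ⟨m, hm⟩ := exists_quadratic_volterra
    ((1 / 2 : ℝ) • (β₁ - α₁) - r • α - ((1 / 2) * r ^ 2 : ℝ) • q) (-α - r • q) (-(1 / 2 : ℝ) • q)
  refine ⟨r, m, ?_⟩
  have hm' := congrArg (fun x : Kernel T => (x : Unitization ℝ (Kernel T))) hm
  have hq' := congrArg (fun x : Kernel T => (x : Unitization ℝ (Kernel T))) hq
  have hα' := congrArg (fun x : Kernel T => (x : Unitization ℝ (Kernel T))) hα
  simp only [Unitization.inr_add, Unitization.inr_mul, inr_smul', Unitization.inr_sub,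
    Unitization.inr_neg, map_mul, map_pow, map_neg] at hm' hq' hα' ⊢
  have hβ : algebraMap ℝ (Unitization ℝ (Kernel T)) β₀ =
      algebraMap ℝ _ α₀ + 2 * algebraMap ℝ _ r := by
    rw [← map_ofNat (algebraMap ℝ (Unitization ℝ (Kernel T))) 2, ← map_mul, ← map_add, hr]
    congr 1; ring
  have h2 : algebraMap ℝ (Unitization ℝ (Kernel T)) (1 / 2) * 2 = 1 := by
    rw [← map_ofNat (algebraMap ℝ (Unitization ℝ (Kernel T))) 2, ← map_mul, ← map_one
      (algebraMap ℝ (Unitization ℝ (Kernel T)))]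
    norm_num
  rw [hβ]
  generalize algebraMap ℝ (Unitization ℝ (Kernel T)) (1 / 2) = w at *
  generalize algebraMap ℝ (Unitization ℝ (Kernel T)) r = R at *
  generalize algebraMap ℝ (Unitization ℝ (Kernel T)) α₀ = A at *
  generalize (unit T : Unitization ℝ (Kernel T)) = J at *
  generalize (α : Unitization ℝ (Kernel T)) = a at *
  generalize (q : Unitization ℝ (Kernel T)) = Q at *
  generalize (m : Unitization ℝ (Kernel T)) = M at *
  generalize (α₁ : Unitization ℝ (Kernel T)) = a1 at *
  generalize (β₁ : Unitization ℝ (Kernel T)) = b1 at *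
  subst hq'
  linear_combination 2 * J * hm' + hα' + J * (b1 - a1 - R ^ 2 * (J + a * J)
    - (J + a * J) * M ^ 2) * h2

/-- With (1 + α)(1 + ρ)² = 1 + β the equation says v = J²/((1 + ρ)² + ω²J²) = 1/(P² + ω²), where P =
(1 + ρ)/J. This is ∫ (e^{-sP}/P) cos(ωs) ds, and neither the flow nor 1/P involves ω. -/
theorem exists_transmutation (α₀ β₀ : ℝ) (α₁ β₁ : Kernel T) :
    ∃ H : ℝ → ℝ → ℝ, Continuous (Function.uncurry H) ∧ ∀ (ω : ℝ) (v : Kernel T),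
      v + (β₀ • unit T + unit T * β₁) * v +
        ω ^ 2 • (unit T * (unit T * v) + (α₀ • unit T + unit T * α₁) * (unit T * (unit T * v))) =
          unit T * unit T + (α₀ • unit T + unit T * α₁) * (unit T * unit T) →
      ∀ t ∈ Icc (0 : ℝ) T, v.ext t = ∫ s in (0 : ℝ)..t, H t s * Real.cos (ω * s) := by
  obtain ⟨r, m, hrm⟩ := exists_sqrt α₀ β₀ α₁ β₁
  -- φ solves (1 + ρ)φ = J, so it plays the part of 1/P.
  obtain ⟨φ, hφ⟩ := exists_quadratic_volterra (unit T) (-(r • unit T + unit T * m)) 0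
  refine ⟨fun t s => (flow r m φ s).ext (t - s), ?_, fun ω v hv t ht => ?_⟩
  · exact (continuous_flow_ext r m φ).comp
      (by fun_prop : Continuous fun p : ℝ × ℝ => (p.2, p.1 - p.2))
  have hc : Continuous fun s => Real.cos (ω * s) := by fun_prop
  have hs : Continuous fun s => Real.sin (ω * s) := by fun_prop
  have hs' : Continuous fun s => ω * Real.cos (ω * s) := by fun_prop
  have hc' : Continuous fun s => -ω * Real.sin (ω * s) := by fun_prop
  have hid : ∀ s, HasDerivAt (fun s => ω * s) ω s := fun s => by
    simpa using (hasDerivAt_id s).const_mul ω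
  -- The cosine and sine waves W and Z satisfy (1 + ρ)W = Jφ - ωJZ and (1 + ρ)Z = ωJW; eliminating Z
  -- gives the equation of v for W.
  have hW := wave_by_parts r m φ hc hc' fun s => by
    convert! (hid s).cos using 1; ring
  have hZ := wave_by_parts r m φ hs hs' fun s => by
    convert! (hid s).sin using 1; ring
  have hlin : ∀ (c : ℝ) (κ : ℝ → ℝ) (hκ : Continuous κ) (hκ' : Continuous fun s => c * κ s)
      (ψ : Kernel T), wave r m ψ (fun s => c * κ s) hκ' = c • wave r m ψ κ hκ :=
    fun c κ hκ hκ' ψ => eq_of_ext fun t ht => by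
      rw [ext_smul, ext_wave _ _ _ _ ht, ext_wave _ _ _ _ ht,
        ← intervalIntegral.integral_const_mul]
      exact intervalIntegral.integral_congr fun s _ => by ring
  have hadd : ∀ (κ : ℝ → ℝ) (hκ : Continuous κ) (ψ χ : Kernel T),
      wave r m (ψ + χ) κ hκ = wave r m ψ κ hκ + wave r m χ κ hκ :=
    fun κ hκ ψ χ => eq_of_ext fun t ht => by
      have hcont : ∀ ψ : Kernel T, Continuous fun s => (flow r m ψ s).ext (t - s) * κ s := fun ψ =>
        ((continuous_flow_ext r m ψ).comp (by fun_prop : Continuous fun s : ℝ => (s, t - s))).mul hκ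
      rw [ext_add, ext_wave _ _ _ _ ht, ext_wave _ _ _ _ ht, ext_wave _ _ _ _ ht,
        ← intervalIntegral.integral_add ((hcont _).intervalIntegrable _ _)
          ((hcont _).intervalIntegrable _ _)]
      exact intervalIntegral.integral_congr fun s _ => by
        simp only [flow_add, ext_add, add_mul]
  rw [hadd, ← mul_wave, hlin _ _ hs, ← mul_wave] at hW
  rw [hadd, ← mul_wave, hlin _ _ hc, ← mul_wave] at hZ
  simp only [mul_zero, Real.cos_zero, one_smul, Real.sin_zero, zero_smul, zero_add] at hW hZ
  set W := wave r m φ _ hc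
  set Z := wave r m φ _ hs
  suffices v = W by rw [this, ext_wave _ _ _ _ ht]
  set α := α₀ • unit T + unit T * α₁
  set β := β₀ • unit T + unit T * β₁
  set ρ := r • unit T + unit T * m
  set N := β + ω ^ 2 • (unit T * unit T + α * (unit T * unit T))
  rw [← sub_eq_zero]
  refine eq_zero_of_add_mul_eq_zero (N := N) (Unitization.inr_injective (R := ℝ) ?_)
  have hN : N = β + ω ^ 2 • (unit T * unit T + α * (unit T * unit T)) := rfl
  have cast : ∀ {x y : Kernel T}, x = y → (x : Unitization ℝ (Kernel T)) = y := fun h => by rw [h]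
  have h1 := cast hv
  have h2 := cast hW
  have h3 := cast hZ
  have h4 := cast hφ
  have h5 := cast hN
  simp only [Unitization.inr_add, Unitization.inr_mul, inr_smul', Unitization.inr_sub,
    Unitization.inr_neg, Unitization.inr_zero, map_pow, map_neg] at h1 h2 h3 h4 h5 ⊢
  generalize algebraMap ℝ (Unitization ℝ (Kernel T)) ω = w at *
  generalize (unit T : Unitization ℝ (Kernel T)) = J at *
  generalize (α : Unitization ℝ (Kernel T)) = a at *
  generalize (β : Unitization ℝ (Kernel T)) = b at *
  generalize (ρ : Unitization ℝ (Kernel T)) = R at *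
  generalize (N : Unitization ℝ (Kernel T)) = n at *
  generalize (W : Unitization ℝ (Kernel T)) = x at *
  generalize (Z : Unitization ℝ (Kernel T)) = z at *
  generalize (v : Unitization ℝ (Kernel T)) = y at *
  generalize (φ : Unitization ℝ (Kernel T)) = f at *
  subst h5
  linear_combination h1 - (1 + a) * (1 + R) * h2 + (1 + a) * w * J * h3 - (1 + a) * J * h4 + x * hrm

end Kernel

/-! ### Modes as kernels: the scalar Volterra equations -/

namespace Kernel

variable {T : ℝ≥0}

/-- The restriction to `[0, T]` of a function continuous on the half line. -/
def ofOn (T : ℝ≥0) (f : ℝ → ℝ) (hf : ContinuousOn f (Ici 0)) : Kernel T :=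
  ofFun T (fun t => f (max t 0)) (hf.comp_continuous (by fun_prop) fun t => le_max_right t 0)

theorem ext_ofOn {f : ℝ → ℝ} (hf : ContinuousOn f (Ici 0)) {t : ℝ} (ht : t ∈ Icc (0 : ℝ) T) :
    (ofOn T f hf).ext t = f t := by
  rw [ofOn, ext_ofFun _ ht, max_eq_left ht.1]

theorem ext_mul_eq_volterra {f g : ℝ → ℝ} {F G : Kernel T}
    (hF : ∀ s ∈ Icc (0 : ℝ) T, F.ext s = f s) (hG : ∀ s ∈ Icc (0 : ℝ) T, G.ext s = g s)
    {t : ℝ} (ht : t ∈ Icc (0 : ℝ) T) : (F * G).ext t = volterra f g t := by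
  rw [ext_mul _ _ ht]
  exact volterra_congr ht.1 (fun s hs => hF s ⟨hs.1, hs.2.trans ht.2⟩)
    fun s hs => hG s ⟨hs.1, hs.2.trans ht.2⟩

theorem ext_unit_mul_eq {f : ℝ → ℝ} {F : Kernel T} (hF : ∀ s ∈ Icc (0 : ℝ) T, F.ext s = f s)
    {t : ℝ} (ht : t ∈ Icc (0 : ℝ) T) : (unit T * F).ext t = ∫ s in (0 : ℝ)..t, f s := by
  rw [ext_unit_mul _ ht]
  refine intervalIntegral.integral_congr fun s hs => ?_
  rw [uIcc_of_le ht.1] at hs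
  exact hF s ⟨hs.1, hs.2.trans ht.2⟩

end Kernel

open Kernel

theorem volterra_continuousOn {f g : ℝ → ℝ} (hf : ContinuousOn f (Ici 0))
    (hg : ContinuousOn g (Ici 0)) : ContinuousOn (volterra f g) (Ici 0) := by
  have hf' : Continuous fun t => f (max t 0) :=
    hf.comp_continuous (by fun_prop) fun t => le_max_right t 0
  have hg' : Continuous fun t => g (max t 0) :=
    hg.comp_continuous (by fun_prop) fun t => le_max_right t 0
  refine (continuous_volterra hf' hg').continuousOn.congr fun t ht => ?_
  exact volterra_congr ht (fun s hs => by simp [hs.1]) fun s hs => by simp [hs.1]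

theorem primitive_continuousOn {g : ℝ → ℝ} (hg : ContinuousOn g (Ici 0)) :
    ContinuousOn (GurtinPipkin.primitive g) (Ici 0) :=
  (volterra_continuousOn hg (continuousOn_const (c := 1))).congr fun t _ =>
    (volterra_one g t).symm

theorem hfun_continuousOn {β g : ℝ → ℝ} (hβ : ContinuousOn β (Ici 0))
    (hg : ContinuousOn g (Ici 0)) : ContinuousOn (GurtinPipkin.hfun β g) (Ici 0) :=
  hg.add (volterra_continuousOn hβ hg)

theorem eq_add_integral_derivWithin {k : ℝ → ℝ} (hk : ContDiffOn ℝ 1 k (Ici 0)) {t : ℝ}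
    (ht : 0 ≤ t) : k t = k 0 + ∫ s in (0 : ℝ)..t, derivWithin k (Ici 0) s := by
  have hc := hk.continuousOn_derivWithin (uniqueDiffOn_Ici 0) le_rfl
  have hsub : Icc 0 t ⊆ Ici 0 := Icc_subset_Ici_self
  rw [intervalIntegral.integral_eq_sub_of_hasDerivAt_of_le ht (hk.continuousOn.mono hsub)]
  · ring
  · intro s hs
    exact ((hk.differentiableOn one_ne_zero) s hs.1.le).hasDerivWithinAt.hasDerivAt
      (Ici_mem_nhds hs.1)
  · exact (hc.mono (by rwa [uIcc_of_le ht])).intervalIntegrable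

theorem ofOn_eq_smul_unit_add {k : ℝ → ℝ} (T : ℝ≥0) (hk : ContDiffOn ℝ 1 k (Ici 0)) :
    ofOn T k hk.continuousOn = k 0 • unit T + unit T * ofOn T (derivWithin k (Ici 0))
      (hk.continuousOn_derivWithin (uniqueDiffOn_Ici 0) le_rfl) :=
  eq_of_ext fun t ht => by
    rw [ext_add, ext_smul, ext_unit ht, ext_unit_mul_eq (fun _ => ext_ofOn _) ht, ext_ofOn _ ht,
      eq_add_integral_derivWithin hk ht.1, mul_one]

/-- Two derivatives of a allow the factorization a = a(0)(J + αJ) with α = a'/a(0), itself of the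
form α₀J + Jα₁. The transmutation then applies to aζ/a(0) with ω = √a(0) μ. -/
theorem exists_mode_transmutation {a β : ℝ → ℝ} (ha : ContDiffOn ℝ 2 a (Ici 0))
    (hβ : ContDiffOn ℝ 2 β (Ici 0)) (ha0 : 0 < a 0) (T : ℝ≥0) :
    ∃ H : ℝ → ℝ → ℝ, Continuous (Function.uncurry H) ∧ ∀ (μ : ℝ) (ζ : ℝ → ℝ),
      ContinuousOn ζ (Ici 0) →
      (∀ t ∈ Icc (0 : ℝ) T,
        ζ t + volterra β ζ t + μ ^ 2 * ∫ s in (0 : ℝ)..t, volterra a ζ s = 1) →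
      ∀ t ∈ Icc (0 : ℝ) T,
        volterra a ζ t = ∫ s in (0 : ℝ)..t, H t s * Real.cos (√(a 0) * μ * s) := by
  have ha1 : ContDiffOn ℝ 1 a (Ici 0) := ha.of_le (by norm_num)
  have hβ1 : ContDiffOn ℝ 1 β (Ici 0) := hβ.of_le (by norm_num)
  have ha' : ContDiffOn ℝ 1 (derivWithin a (Ici 0)) (Ici 0) :=
    ha.derivWithin (uniqueDiffOn_Ici 0) (by norm_num)
  have ea := ofOn_eq_smul_unit_add T ha1
  have ea' := ofOn_eq_smul_unit_add T ha'
  have eβ := ofOn_eq_smul_unit_add T hβ1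
  set A := ofOn T a ha1.continuousOn
  set B := ofOn T β hβ1.continuousOn
  set A' := ofOn T (derivWithin a (Ici 0)) ha'.continuousOn
  set A'' := ofOn T (derivWithin (derivWithin a (Ici 0)) (Ici 0))
    (ha'.continuousOn_derivWithin (uniqueDiffOn_Ici 0) le_rfl)
  set B' := ofOn T (derivWithin β (Ici 0)) (hβ1.continuousOn_derivWithin (uniqueDiffOn_Ici 0) le_rfl)
  obtain ⟨H, hH, hsol⟩ := exists_transmutation ((a 0)⁻¹ * derivWithin a (Ici 0) 0) (β 0)
    ((a 0)⁻¹ • A'') B'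
  refine ⟨fun t s => a 0 * H t s, by simpa only [Function.uncurry_def] using hH.const_mul (a 0),
    fun μ ζ hζ heq t ht => ?_⟩
  set α := ((a 0)⁻¹ * derivWithin a (Ici 0) 0) • unit T + unit T * ((a 0)⁻¹ • A'') with hα
  have eα : α = (a 0)⁻¹ • A' := by
    rw [hα, ea', smul_add, mul_smul, mul_smul_comm]
  have hζk := fun s (hs : s ∈ Icc (0 : ℝ) T) => ext_ofOn (T := T) hζ hs
  set Z := ofOn T ζ hζ
  have hAk : ∀ s ∈ Icc (0 : ℝ) T, A.ext s = a s := fun s hs => ext_ofOn _ hs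
  have hBk : ∀ s ∈ Icc (0 : ℝ) T, B.ext s = β s := fun s hs => ext_ofOn _ hs
  have hAZ := fun s hs => ext_mul_eq_volterra (t := s) hAk hζk hs
  have e1 : Z + B * Z + μ ^ 2 • (unit T * (A * Z)) = unit T := eq_of_ext fun s hs => by
    rw [ext_add, ext_add, ext_smul, ext_unit hs, ext_mul_eq_volterra hBk hζk hs, hζk s hs,
      ext_unit_mul_eq hAZ hs, heq s hs]
  have e2 : A = a 0 • (unit T + α * unit T) := by
    rw [ea, eα, smul_add, smul_mul_assoc, smul_smul, mul_inv_cancel₀ ha0.ne', one_smul, mul_comm A']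
  have key := hsol (√(a 0) * μ) ((a 0)⁻¹ • (A * Z)) ?_ t ht
  · rw [ext_smul, hAZ t ht] at key
    simp only [mul_assoc (a 0), intervalIntegral.integral_const_mul]
    rw [← key, mul_inv_cancel_left₀ ha0.ne']
  · rw [← eβ, mul_pow, Real.sq_sqrt ha0.le]
    refine Unitization.inr_injective (R := ℝ) ?_
    have cast : ∀ {x y : Kernel T}, x = y → (x : Unitization ℝ (Kernel T)) = y := fun h => by rw [h]
    have h1 := cast e1
    have h2 := cast e2
    have h3 : algebraMap ℝ (Unitization ℝ (Kernel T)) (a 0) * algebraMap ℝ _ (a 0)⁻¹ = 1 := by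
      rw [← map_mul, mul_inv_cancel₀ ha0.ne', map_one]
    simp only [Unitization.inr_add, Unitization.inr_mul, inr_smul', map_pow, map_mul] at h1 h2 ⊢
    generalize algebraMap ℝ (Unitization ℝ (Kernel T)) (a 0) = c at *
    generalize algebraMap ℝ (Unitization ℝ (Kernel T)) (a 0)⁻¹ = d at *
    generalize algebraMap ℝ (Unitization ℝ (Kernel T)) μ = w at *
    generalize (unit T : Unitization ℝ (Kernel T)) = J at *
    generalize (α : Unitization ℝ (Kernel T)) = x at *
    generalize (A : Unitization ℝ (Kernel T)) = y at *
    generalize (B : Unitization ℝ (Kernel T)) = b at *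
    generalize (Z : Unitization ℝ (Kernel T)) = z at *
    subst h2
    linear_combination (J + x * J) * h1 + (J + x * J) * (z + b * z
      + c * w ^ 2 * J * (J + x * J) * z) * h3

/-- Applied to γ(ξJg - hz), the operator 1 + β + μ²Ja leaves γμ²ξ JaJg, because the terms ξJh
cancel; μξ = 1 makes this the source of y. Injectivity identifies y, and convolution with a
finishes. -/
theorem mode_boundary_eq {a β g z y : ℝ → ℝ} {γ μ ξ : ℝ} (ha : ContinuousOn a (Ici 0))
    (hβ : ContinuousOn β (Ici 0)) (hg : ContinuousOn g (Ici 0)) (hz : ContinuousOn z (Ici 0))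
    (hy : ContinuousOn y (Ici 0)) (hμξ : μ * ξ = 1)
    (hzeq : ∀ t, 0 ≤ t →
      z t + volterra β z t + μ ^ 2 * ∫ s in (0 : ℝ)..t, volterra a z s = ξ)
    (hyeq : ∀ t, 0 ≤ t →
      y t + volterra β y t + μ ^ 2 * ∫ s in (0 : ℝ)..t, volterra a y s =
        γ * μ * ∫ s in (0 : ℝ)..t, volterra a (GurtinPipkin.primitive g) s)
    {t : ℝ} (ht : 0 ≤ t) :
    volterra a y t = γ * (ξ * volterra a (GurtinPipkin.primitive g) t
      - volterra (GurtinPipkin.hfun β g) (volterra a z) t) := by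
  lift t to ℝ≥0 using ht with T
  have hG := fun s (hs : s ∈ Icc (0 : ℝ) T) => ext_ofOn (T := T) hg hs
  have hA := fun s (hs : s ∈ Icc (0 : ℝ) T) => ext_ofOn (T := T) ha hs
  have hB := fun s (hs : s ∈ Icc (0 : ℝ) T) => ext_ofOn (T := T) hβ hs
  have hZ := fun s (hs : s ∈ Icc (0 : ℝ) T) => ext_ofOn (T := T) hz hs
  have hY := fun s (hs : s ∈ Icc (0 : ℝ) T) => ext_ofOn (T := T) hy hs
  set G := ofOn T g hg
  set A := ofOn T a ha
  set B := ofOn T β hβ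
  set Z := ofOn T z hz
  set Y := ofOn T y hy
  have hF : ∀ s ∈ Icc (0 : ℝ) T, (unit T * G).ext s = GurtinPipkin.primitive g s :=
    fun s hs => ext_unit_mul_eq hG hs
  have hH : ∀ s ∈ Icc (0 : ℝ) T, (G + B * G).ext s = GurtinPipkin.hfun β g s := fun s hs => by
    rw [ext_add, hG s hs, ext_mul_eq_volterra hB hG hs]; rfl
  have hAZ := fun s hs => ext_mul_eq_volterra (t := s) hA hZ hs
  have hAY := fun s hs => ext_mul_eq_volterra (t := s) hA hY hs
  have hAF := fun s hs => ext_mul_eq_volterra (t := s) hA hF hs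
  have e1 : Z + B * Z + μ ^ 2 • (unit T * (A * Z)) = ξ • unit T := eq_of_ext fun s hs => by
    rw [ext_add, ext_add, ext_smul, ext_smul, ext_unit hs, ext_mul_eq_volterra hB hZ hs, hZ s hs,
      ext_unit_mul_eq hAZ hs, hzeq s hs.1, mul_one]
  have e2 : Y + B * Y + μ ^ 2 • (unit T * (A * Y)) =
      (γ * μ) • (unit T * (A * (unit T * G))) := eq_of_ext fun s hs => by
    rw [ext_add, ext_add, ext_smul, ext_smul, ext_mul_eq_volterra hB hY hs, hY s hs,
      ext_unit_mul_eq hAY hs, hyeq s hs.1, ext_unit_mul_eq hAF hs]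
  have e3 : Y = γ • (ξ • (unit T * G) - (G + B * G) * Z) := by
    rw [← sub_eq_zero]
    refine eq_zero_of_add_mul_eq_zero (N := B + μ ^ 2 • (unit T * A)) ?_
    refine Unitization.inr_injective (R := ℝ) ?_
    have cast : ∀ {x y : Kernel T}, x = y → (x : Unitization ℝ (Kernel T)) = y := fun h => by rw [h]
    have h1 := cast e1
    have h2 := cast e2
    have h3 : algebraMap ℝ (Unitization ℝ (Kernel T)) μ * algebraMap ℝ _ ξ = 1 := by
      rw [← map_mul, hμξ, map_one]
    simp only [Unitization.inr_add, Unitization.inr_mul, Unitization.inr_sub, Unitization.inr_zero,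
      inr_smul', map_pow, map_mul] at h1 h2 ⊢
    generalize algebraMap ℝ (Unitization ℝ (Kernel T)) μ = w at *
    generalize algebraMap ℝ (Unitization ℝ (Kernel T)) ξ = x at *
    generalize algebraMap ℝ (Unitization ℝ (Kernel T)) γ = c at *
    generalize (unit T : Unitization ℝ (Kernel T)) = J at *
    linear_combination h2 + c * (G + B * G) * h1 - c * w * J * J * A * G * h3
  have e4 : A * Y = γ • (ξ • (A * (unit T * G)) - (G + B * G) * (A * Z)) := by
    rw [e3, mul_smul_comm, mul_sub, mul_smul_comm, mul_left_comm A (G + B * G)]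
  have hT : (T : ℝ) ∈ Icc (0 : ℝ) T := ⟨T.2, le_rfl⟩
  rw [← hAY T hT, e4, ext_smul, ext_sub, ext_smul, hAF T hT, ext_mul_eq_volterra hH hAZ hT]

/-! ### Completeness of the sines, weak derivatives and uniqueness of the flux -/

theorem ae_eq_zero_of_integral_continuous_mul {L : ℝ} (hL : 0 ≤ L) {u : ℝ → ℝ}
    (hu : IntegrableOn u (Ioo 0 L))
    (h : ∀ ψ : ℝ → ℝ, Continuous ψ → ∫ x in (0 : ℝ)..L, u x * ψ x = 0) :
    ∀ᵐ x ∂(volume.restrict (Ioo (0 : ℝ) L)), u x = 0 := by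
  rw [ae_restrict_iff' measurableSet_Ioo]
  refine isOpen_Ioo.ae_eq_zero_of_integral_contDiff_smul_eq_zero hu.locallyIntegrableOn
    fun ψ hψ _ hsupp => ?_
  have h1 : ∀ x, x ∉ Ioo 0 L → ψ x • u x = 0 := fun x hx => by
    rw [image_eq_zero_of_notMem_tsupport fun hx' => hx (hsupp hx'), zero_smul]
  rw [← setIntegral_eq_integral_of_forall_compl_eq_zero h1, ← integral_Ioc_eq_integral_Ioo,
    ← intervalIntegral.integral_of_le hL]
  refine Eq.trans ?_ (h ψ hψ.continuous)
  exact intervalIntegral.integral_congr fun x _ => mul_comm (ψ x) (u x)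

/-- Weierstrass approximation in the variable θ. It serves below with θ a cosine, a decaying
exponential and the identity. -/
theorem integral_mul_eq_zero_of_polynomial {L A B : ℝ} (hL : 0 ≤ L) {v θ ψ χ : ℝ → ℝ}
    (hv : IntervalIntegrable v volume 0 L) (hθ : Continuous θ) (hψ : Continuous ψ)
    (hχ : ContinuousOn χ (Icc A B)) (hθm : ∀ x ∈ Icc 0 L, θ x ∈ Icc A B)
    (hψχ : ∀ x ∈ Icc 0 L, ψ x = χ (θ x))
    (hmom : ∀ k : ℕ, ∫ x in (0 : ℝ)..L, v x * θ x ^ k = 0) :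
    ∫ x in (0 : ℝ)..L, v x * ψ x = 0 := by
  have hpoly : ∀ p : Polynomial ℝ, ∫ x in (0 : ℝ)..L, v x * p.eval (θ x) = 0 := fun p => by
    induction p using Polynomial.induction_on' with
    | add p q hp hq =>
      simp only [Polynomial.eval_add, mul_add]
      rw [intervalIntegral.integral_add, hp, hq, add_zero]
      · exact hv.mul_continuousOn (by fun_prop)
      · exact hv.mul_continuousOn (by fun_prop)
    | monomial n c =>
      simp only [Polynomial.eval_monomial, mul_left_comm _ c]
      rw [intervalIntegral.integral_const_mul, hmom, mul_zero]
  have hbound : ∀ ε > 0, |∫ x in (0 : ℝ)..L, v x * ψ x| ≤ ε * ∫ x in (0 : ℝ)..L, |v x| := fun ε hε => by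
    obtain ⟨p, hp⟩ := exists_polynomial_near_of_continuousOn A B χ hχ ε hε
    have e : ∫ x in (0 : ℝ)..L, v x * ψ x =
        ∫ x in (0 : ℝ)..L, v x * (ψ x - p.eval (θ x)) := by
      simp only [mul_sub]
      rw [intervalIntegral.integral_sub, hpoly, sub_zero]
      · exact hv.mul_continuousOn (by fun_prop)
      · exact hv.mul_continuousOn (by fun_prop)
    rw [e, ← intervalIntegral.integral_const_mul]
    rw [← Real.norm_eq_abs]
    refine intervalIntegral.norm_integral_le_of_norm_le hL (Eventually.of_forall fun x hx => ?_)
      (hv.abs.const_mul ε)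
    have hx' := Ioc_subset_Icc_self hx
    rw [norm_mul, mul_comm, hψχ x hx', Real.norm_eq_abs, Real.norm_eq_abs, abs_sub_comm]
    exact mul_le_mul_of_nonneg_right (hp _ (hθm x hx')).le (abs_nonneg _)
  have hlim : Tendsto (fun ε : ℝ => ε * ∫ x in (0 : ℝ)..L, |v x|) (𝓝[>] 0) (𝓝 0) :=
    tendsto_nhdsWithin_of_tendsto_nhds (Continuous.tendsto' (by fun_prop) _ _ (by simp))
  have := ge_of_tendsto hlim (eventually_nhdsWithin_of_forall hbound)
  exact abs_nonpos_iff.1 this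

namespace GurtinPipkin

/-- Product-to-sum formulas show u · sin(πx/L) orthogonal to all powers of cos(πx/L). The cosine is
injective on [0, L], so this product vanishes almost everywhere, and the sine is positive inside. -/
theorem ae_eq_zero_of_sine_coeffs {L : ℝ} (hL : 0 < L) {u : ℝ → ℝ}
    (hu : IntegrableOn u (Ioo 0 L))
    (h : ∀ n : ℕ, 1 ≤ n → ∫ x in (0 : ℝ)..L, u x * Real.sin (freq L n * x) = 0) :
    ∀ᵐ x ∂(volume.restrict (Ioo (0 : ℝ) L)), u x = 0 := by
  have hui : IntervalIntegrable u volume 0 L :=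
    (intervalIntegrable_iff_integrableOn_Ioo_of_le hL.le).2 hu
  set c := Real.pi / L with hc
  have hc0 : 0 < c := div_pos Real.pi_pos hL
  have hmom : ∀ k n : ℕ, ∫ x in (0 : ℝ)..L,
      u x * Real.sin (n * (c * x)) * Real.cos (c * x) ^ k = 0 := fun k => by
    induction k with
    | zero =>
      intro n
      rcases n.eq_zero_or_pos with rfl | hn
      · simp
      · simpa [freq, mul_assoc] using h n hn
    | succ k ih =>
      have hint : ∀ n : ℕ, IntervalIntegrable
          (fun x => u x * Real.sin (n * (c * x)) * Real.cos (c * x) ^ k) volume 0 L := fun n =>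
        (hui.mul_continuousOn (by fun_prop)).mul_continuousOn (by fun_prop)
      intro n
      rcases n.eq_zero_or_pos with rfl | hn
      · simp
      · obtain ⟨m, rfl⟩ : ∃ m, n = m + 1 := ⟨n - 1, by omega⟩
        have e : ∀ x, u x * Real.sin ((m + 1 : ℕ) * (c * x)) * Real.cos (c * x) ^ (k + 1) =
            1 / 2 * (u x * Real.sin ((m + 2 : ℕ) * (c * x)) * Real.cos (c * x) ^ k +
              u x * Real.sin (m * (c * x)) * Real.cos (c * x) ^ k) := fun x => by
          push_cast
          rw [show ((m : ℝ) + 2) * (c * x) = (m + 1) * (c * x) + c * x by ring,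
            show (m : ℝ) * (c * x) = (m + 1) * (c * x) - c * x by ring, Real.sin_add, Real.sin_sub]
          ring
        simp only [e]
        rw [intervalIntegral.integral_const_mul,
          intervalIntegral.integral_add (hint _) (hint _), ih, ih]
        simp
  have hsin : ∀ᵐ x ∂(volume.restrict (Ioo (0 : ℝ) L)), u x * Real.sin (c * x) = 0 := by
    have hvi : IntervalIntegrable (fun x => u x * Real.sin (c * x)) volume 0 L :=
      hui.mul_continuousOn (by fun_prop)
    refine ae_eq_zero_of_integral_continuous_mul hL.le
      ((intervalIntegrable_iff_integrableOn_Ioo_of_le hL.le).1 hvi) fun ψ hψ => ?_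
    refine integral_mul_eq_zero_of_polynomial (A := -1) (B := 1) hL.le hvi
      (θ := fun x => Real.cos (c * x)) (χ := fun y => ψ (Real.arccos y / c)) (by fun_prop) hψ
      (hψ.comp (Real.continuous_arccos.div_const c)).continuousOn
      (fun x _ => ⟨Real.neg_one_le_cos _, Real.cos_le_one _⟩) (fun x hx => ?_) fun k => ?_
    · have h1 : c * x ≤ Real.pi := by
        calc c * x ≤ c * L := by gcongr; exact hx.2
          _ = Real.pi := by rw [hc]; field_simp
      rw [Real.arccos_cos (by have := hx.1; positivity) h1, mul_div_cancel_left₀ _ hc0.ne']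
    · simpa using hmom k 1
  rw [ae_restrict_iff' measurableSet_Ioo] at hsin ⊢
  filter_upwards [hsin] with x hx hx'
  refine (mul_eq_zero.1 (hx hx')).resolve_right (Real.sin_pos_of_pos_of_lt_pi ?_ ?_).ne'
  · exact mul_pos hc0 hx'.1
  · calc c * x < c * L := by gcongr; exact hx'.2
      _ = Real.pi := by rw [hc]; field_simp

theorem freq_pos {L : ℝ} (hL : 0 < L) {n : ℕ} (hn : 1 ≤ n) : 0 < freq L n := by
  have : (0 : ℝ) < n := by exact_mod_cast hn
  unfold freq
  positivity

/-- The hypothesis is integration by parts for the primitive of -q vanishing at L. Fubini replaces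
the integration by parts, as q is only integrable. -/
theorem ae_eq_of_sine_coeffs {L : ℝ} (hL : 0 < L) {u q : ℝ → ℝ}
    (hu : IntegrableOn u (Ioo 0 L)) (hq : IntegrableOn q (Ioo 0 L))
    (h : ∀ n : ℕ, 1 ≤ n → freq L n * ∫ x in (0 : ℝ)..L, u x * Real.sin (freq L n * x) =
      (∫ x in (0 : ℝ)..L, q x) - ∫ x in (0 : ℝ)..L, q x * Real.cos (freq L n * x)) :
    ∀ᵐ x ∂(volume.restrict (Ioo (0 : ℝ) L)),
      u x = (∫ x' in (0 : ℝ)..L, q x') - ∫ x' in (0 : ℝ)..x, q x' := by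
  have hqi : IntervalIntegrable q volume 0 L :=
    (intervalIntegrable_iff_integrableOn_Ioo_of_le hL.le).2 hq
  have hui : IntervalIntegrable u volume 0 L :=
    (intervalIntegrable_iff_integrableOn_Ioo_of_le hL.le).2 hu
  have hpc : ContinuousOn (fun x => (∫ x' in (0 : ℝ)..L, q x') - ∫ x' in (0 : ℝ)..x, q x')
      (uIcc 0 L) :=
    continuousOn_const.sub
      (intervalIntegral.continuousOn_primitive_interval' hqi left_mem_uIcc)
  have hpi := hpc.intervalIntegrable (μ := volume)
  have := ae_eq_zero_of_sine_coeffs hL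
    ((intervalIntegrable_iff_integrableOn_Ioo_of_le hL.le).1 (hui.sub hpi)) fun n hn => ?_
  · filter_upwards [this] with x hx
    exact sub_eq_zero.1 hx
  have hf := freq_pos hL hn
  set μ := freq L n
  simp only [sub_mul]
  have hs : ContinuousOn (fun x => Real.sin (μ * x)) (uIcc 0 L) := by fun_prop
  have i1 := hui.mul_continuousOn hs
  have i2 := hpi.mul_continuousOn hs
  simp only [sub_mul] at i2
  rw [intervalIntegral.integral_sub i1 i2, sub_eq_zero]
  refine mul_left_cancel₀ hf.ne' ?_
  rw [h n hn, ← intervalIntegral.integral_sub hqi (hqi.mul_continuousOn (by fun_prop)),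
    ← intervalIntegral.integral_const_mul]
  have hsw := integral_triangle_swap_of_integrableOn
    (F := fun τ x => q τ * (μ * Real.sin (μ * x))) (t := L) ?_ hL.le
  · convert! hsw using 1
    · refine intervalIntegral.integral_congr fun τ _ => ?_
      have hd : ∀ x ∈ uIcc 0 τ,
          HasDerivAt (fun x => -Real.cos (μ * x)) (μ * Real.sin (μ * x)) x := fun x _ => by
        have h1 : HasDerivAt (fun x => μ * x) μ x := by simpa using (hasDerivAt_id x).const_mul μ
        convert! h1.cos.neg using 1; ring
      rw [intervalIntegral.integral_const_mul, intervalIntegral.integral_eq_sub_of_hasDerivAt hd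
        ((by fun_prop : Continuous fun x => μ * Real.sin (μ * x)).intervalIntegrable _ _)]
      simp
      ring
    · refine intervalIntegral.integral_congr fun x hx => ?_
      rw [intervalIntegral.integral_mul_const, ← sub_mul,
        intervalIntegral.integral_interval_sub_left hqi
          (hqi.mono_set (uIcc_subset_uIcc left_mem_uIcc hx))]
      ring
  · have hq' : Integrable q (volume.restrict (Ioc 0 L)) :=
      (intervalIntegrable_iff_integrableOn_Ioc_of_le hL.le).1 hqi
    have hs' : Integrable (fun x => μ * Real.sin (μ * x)) (volume.restrict (Ioc 0 L)) :=
      (intervalIntegrable_iff_integrableOn_Ioc_of_le hL.le).1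
        ((by fun_prop : Continuous fun x => μ * Real.sin (μ * x)).intervalIntegrable 0 L)
    rw [IntegrableOn, ← Measure.prod_restrict]
    exact hq'.mul_prod hs'

theorem ae_eq_of_primitive_ae_eq {L : ℝ} (hL : 0 < L) {q q' : ℝ → ℝ} {c c' : ℝ}
    (hq : IntegrableOn q (Ioo 0 L)) (hq' : IntegrableOn q' (Ioo 0 L))
    (h : ∀ᵐ x ∂(volume.restrict (Ioo (0 : ℝ) L)),
      c - ∫ x' in (0 : ℝ)..x, q x' = c' - ∫ x' in (0 : ℝ)..x, q' x') :
    ∀ᵐ x ∂(volume.restrict (Ioo (0 : ℝ) L)), q x = q' x := by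
  have hqi : IntervalIntegrable q volume 0 L :=
    (intervalIntegrable_iff_integrableOn_Ioo_of_le hL.le).2 hq
  have hqi' : IntervalIntegrable q' volume 0 L :=
    (intervalIntegrable_iff_integrableOn_Ioo_of_le hL.le).2 hq'
  have hsub : Ioo 0 L ⊆ uIcc 0 L := by rw [uIcc_of_le hL.le]; exact Ioo_subset_Icc_self
  have heq := Measure.eqOn_open_of_ae_eq h isOpen_Ioo
    ((continuousOn_const.sub
      (intervalIntegral.continuousOn_primitive_interval' hqi left_mem_uIcc)).mono hsub)
    ((continuousOn_const.sub
      (intervalIntegral.continuousOn_primitive_interval' hqi' left_mem_uIcc)).mono hsub)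
  rw [ae_restrict_iff' measurableSet_Ioo]
  filter_upwards [hqi.ae_hasDerivAt_integral, hqi'.ae_hasDerivAt_integral] with x h1 h2 hx
  have d1 := (h1 (hsub hx) 0 left_mem_uIcc).const_sub c
  have d2 := (h2 (hsub hx) 0 left_mem_uIcc).const_sub c'
  have := (d1.congr_of_eventuallyEq (f₁ := fun x => c' - ∫ x' in (0 : ℝ)..x, q' x')
    (by filter_upwards [Ioo_mem_nhds hx.1 hx.2] with y hy using (heq hy).symm)).unique d2
  exact neg_injective this

/-- Two densities agree almost everywhere by Lebesgue differentiation, hence at points arbitrarily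
close to L, where their limits are taken. -/
theorem IsFluxAtRight.unique {L : ℝ} (hL : 0 < L) {a : ℝ → ℝ} {θ : ℝ → L2 L} {t y y' : ℝ}
    (h : IsFluxAtRight L a θ t y) (h' : IsFluxAtRight L a θ t y') : y = y' := by
  obtain ⟨q, hq, ⟨c, hc⟩, hy⟩ := h
  obtain ⟨q', hq', ⟨c', hc'⟩, hy'⟩ := h'
  have hae := ae_eq_of_primitive_ae_eq hL (c := c) (c' := c') hq hq' (by
    filter_upwards [hc, hc'] with x h1 h2 using h1.symm.trans h2)
  rw [ae_restrict_iff' measurableSet_Ioo] at hae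
  have hfreq : ∃ᶠ x in 𝓝[<] L, q x = q' x := by
    rw [Filter.frequently_iff]
    intro U hU
    obtain ⟨l, hl, hlU⟩ := (mem_nhdsLT_iff_exists_Ioo_subset' hL).1 hU
    have hlt : max l 0 < L := max_lt hl hL
    have hpos : volume (Ioo (max l 0) L) ≠ 0 := by simpa using hlt
    obtain ⟨x, hx, hx'⟩ := (frequently_ae_mem_iff.2 hpos).and_eventually hae |>.exists
    exact ⟨x, hlU ⟨(le_max_left _ _).trans_lt hx.1, hx.2⟩, hx' ⟨(le_max_right _ _).trans_lt hx.1, hx.2⟩⟩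
  exact tendsto_nhds_unique_of_frequently_eq hy hy' hfreq

end GurtinPipkin

/-! ### Unfolding by reflections: a profile with prescribed cosine coefficients -/

namespace GurtinPipkin

/-- The unfolding of `[0, L]` onto `[k L, (k + 1) L]` by repeated reflection. -/
def unfolding (L : ℝ) (k : ℕ) (x : ℝ) : ℝ := if Even k then k * L + x else (k + 1) * L - x

/-- The function `y ↦ H(t, y / c) / c`, cut off at the wave front `y = c t`. -/
def front (c : ℝ) (H : ℝ → ℝ → ℝ) (t y : ℝ) : ℝ := if y ≤ c * t then H t (y / c) / c else 0

/-- The superposition of the first `M` reflections. -/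
def reflections (L c : ℝ) (H : ℝ → ℝ → ℝ) (M : ℕ) (t x : ℝ) : ℝ :=
  ∑ k ∈ Finset.range M, front c H t (unfolding L k x)

theorem continuous_unfold (L : ℝ) (k : ℕ) : Continuous (unfolding L k) := by
  by_cases hk : Even k
  · simp only [funext fun x => show unfolding L k x = k * L + x by simp [unfolding, hk]]; fun_prop
  · simp only [funext fun x => show unfolding L k x = (k + 1) * L - x by simp [unfolding, hk]]; fun_prop

theorem unfold_nonneg {L : ℝ} (k : ℕ) {x : ℝ} (hx : x ∈ Icc 0 L) : 0 ≤ unfolding L k x := by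
  have hL : 0 ≤ L := hx.1.trans hx.2
  have hk : (0 : ℝ) ≤ k := k.cast_nonneg
  unfold unfolding
  split_ifs
  · have := hx.1; positivity
  · nlinarith [hx.2, mul_nonneg hk hL]

theorem continuous_uncurry_div {c : ℝ} {H : ℝ → ℝ → ℝ} (hH : Continuous (Function.uncurry H)) :
    Continuous fun p : ℝ × ℝ => H p.1 (p.2 / c) / c :=
  (hH.comp (by fun_prop : Continuous fun p : ℝ × ℝ => (p.1, p.2 / c))).div_const c

theorem measurable_front {c : ℝ} {H : ℝ → ℝ → ℝ} (hH : Continuous (Function.uncurry H)) :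
    Measurable (Function.uncurry (front c H)) :=
  Measurable.ite (measurableSet_le measurable_snd (measurable_fst.const_mul c))
    (continuous_uncurry_div hH).measurable measurable_const

theorem measurable_reflections {L c : ℝ} {H : ℝ → ℝ → ℝ} (hH : Continuous (Function.uncurry H))
    (M : ℕ) : Measurable (Function.uncurry (reflections L c H M)) := by
  simp only [Function.uncurry_def, reflections]
  refine Finset.measurable_fun_sum (f := fun k (p : ℝ × ℝ) => front c H p.1 (unfolding L k p.2)) _ fun k _ => ?_
  exact (measurable_front hH).comp
    (measurable_fst.prodMk ((continuous_unfold L k).measurable.comp measurable_snd))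

theorem intervalIntegrable_front {c : ℝ} {H : ℝ → ℝ → ℝ} (hH : Continuous (Function.uncurry H))
    (t A B : ℝ) : IntervalIntegrable (front c H t) volume A B := by
  have h1 : Continuous fun y => H t (y / c) / c :=
    (continuous_uncurry_div hH).comp (by fun_prop : Continuous fun y : ℝ => (t, y))
  have h2 : front c H t = (Iic (c * t)).indicator fun y => H t (y / c) / c := by
    ext y
    by_cases h : y ≤ c * t <;> simp [front, h]
  rw [h2, intervalIntegrable_iff]
  exact ((intervalIntegrable_iff.1 (h1.intervalIntegrable A B))).indicator measurableSet_Iic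

theorem front_left_lim {c : ℝ} {H : ℝ → ℝ → ℝ} (hH : Continuous (Function.uncurry H)) (t y : ℝ) :
    ∃ l, Tendsto (front c H t) (𝓝[<] y) (𝓝 l) := by
  have h1 : Continuous fun y => H t (y / c) / c :=
    (continuous_uncurry_div hH).comp (by fun_prop : Continuous fun y : ℝ => (t, y))
  rcases le_or_gt y (c * t) with h | h
  · refine ⟨_, (h1.tendsto y).mono_left nhdsWithin_le_nhds |>.congr' ?_⟩
    filter_upwards [self_mem_nhdsWithin] with z hz
    rw [front, if_pos (le_trans (le_of_lt hz) h)]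
  · refine ⟨0, tendsto_const_nhds.congr' ?_⟩
    filter_upwards [mem_nhdsWithin_of_mem_nhds (Ioi_mem_nhds h)] with z hz
    rw [front, if_neg (not_le.2 hz)]

theorem front_right_lim {c : ℝ} {H : ℝ → ℝ → ℝ} (hH : Continuous (Function.uncurry H)) (t y : ℝ) :
    ∃ l, Tendsto (front c H t) (𝓝[>] y) (𝓝 l) := by
  have h1 : Continuous fun y => H t (y / c) / c :=
    (continuous_uncurry_div hH).comp (by fun_prop : Continuous fun y : ℝ => (t, y))
  rcases lt_or_ge y (c * t) with h | h
  · refine ⟨_, (h1.tendsto y).mono_left nhdsWithin_le_nhds |>.congr' ?_⟩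
    filter_upwards [mem_nhdsWithin_of_mem_nhds (Iio_mem_nhds h)] with z hz
    rw [front, if_pos (le_of_lt hz)]
  · refine ⟨0, tendsto_const_nhds.congr' ?_⟩
    filter_upwards [self_mem_nhdsWithin] with z hz
    rw [front, if_neg (not_le.2 (h.trans_lt hz))]

theorem reflections_left_lim {L c : ℝ} {H : ℝ → ℝ → ℝ} (hH : Continuous (Function.uncurry H))
    (M : ℕ) (t : ℝ) : ∃ l, Tendsto (reflections L c H M t) (𝓝[<] L) (𝓝 l) := by
  have h : ∀ k : ℕ, ∃ l, Tendsto (fun x => front c H t (unfolding L k x)) (𝓝[<] L) (𝓝 l) := fun k => by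
    have hu := (continuous_unfold L k).tendsto L
    -- Even reflections keep the orientation and odd ones reverse it. The side matters because the
    -- front may jump at y = ct.
    by_cases hk : Even k
    · obtain ⟨l, hl⟩ := front_left_lim (c := c) hH t (unfolding L k L)
      refine ⟨l, hl.comp (tendsto_nhdsWithin_iff.2 ⟨hu.mono_left nhdsWithin_le_nhds, ?_⟩)⟩
      filter_upwards [self_mem_nhdsWithin] with x hx
      have hx' : x < L := hx
      simp [unfolding, hk, hx']
    · obtain ⟨l, hl⟩ := front_right_lim (c := c) hH t (unfolding L k L)
      refine ⟨l, hl.comp (tendsto_nhdsWithin_iff.2 ⟨hu.mono_left nhdsWithin_le_nhds, ?_⟩)⟩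
      filter_upwards [self_mem_nhdsWithin] with x hx
      have hx' : x < L := hx
      simp [unfolding, hk, hx']
  choose l hl using h
  exact ⟨∑ k ∈ Finset.range M, l k, tendsto_finsetSum _ fun k _ => hl k⟩

theorem cos_freq_unfold {L : ℝ} (hL : 0 < L) (n k : ℕ) (x : ℝ) :
    Real.cos (freq L n * unfolding L k x) = Real.cos (freq L n * x) := by
  by_cases hk : Even k
  · obtain ⟨j, rfl⟩ := hk
    have : freq L n * unfolding L (j + j) x = freq L n * x + (n * j : ℕ) * (2 * Real.pi) := by
      simp only [unfolding, Even.add_self, if_true, freq]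
      push_cast; field_simp; ring
    rw [this, Real.cos_add_nat_mul_two_pi]
  · obtain ⟨j, rfl⟩ := Nat.not_even_iff_odd.1 hk
    have : freq L n * unfolding L (2 * j + 1) x =
        (n * (j + 1) : ℕ) * (2 * Real.pi) - freq L n * x := by
      simp only [unfolding, if_neg hk, freq]
      push_cast; field_simp; ring
    rw [this, Real.cos_nat_mul_two_pi_sub]

theorem integral_unfold {L : ℝ} (f : ℝ → ℝ) (k : ℕ) :
    ∫ x in (0 : ℝ)..L, f (unfolding L k x) = ∫ y in (k * L : ℝ)..((k + 1 : ℕ) * L : ℝ), f y := by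
  push_cast
  by_cases hk : Even k
  · simp only [unfolding, if_pos hk]
    rw [intervalIntegral.integral_comp_add_left]
    congr 1 <;> ring
  · simp only [unfolding, if_neg hk]
    rw [intervalIntegral.integral_comp_sub_left]
    congr 1 <;> ring

theorem intervalIntegrable_front_unfold {L c : ℝ} {H : ℝ → ℝ → ℝ}
    (hH : Continuous (Function.uncurry H)) (t : ℝ) (k : ℕ) :
    IntervalIntegrable (fun x => front c H t (unfolding L k x)) volume 0 L := by
  by_cases hk : Even k
  · simp only [unfolding, if_pos hk]
    simpa using (intervalIntegrable_front (c := c) hH t (k * L) (k * L + L)).comp_add_left (k * L)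
  · simp only [unfolding, if_neg hk]
    simpa using (intervalIntegrable_front (c := c) hH t ((k + 1) * L) ((k + 1) * L - L)).comp_sub_left
      ((k + 1) * L)

theorem intervalIntegrable_reflections {L c : ℝ} {H : ℝ → ℝ → ℝ}
    (hH : Continuous (Function.uncurry H)) (M : ℕ) (t : ℝ) :
    IntervalIntegrable (reflections L c H M t) volume 0 L := by
  have := IntervalIntegrable.sum (μ := volume) (a := 0) (b := L) (Finset.range M)
    (f := fun k x => front c H t (unfolding L k x))
    fun k _ => intervalIntegrable_front_unfold hH t k
  convert! this using 1
  ext x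
  simp [reflections]

/-- The cosines are invariant under the unfolding, so the M copies add up to one integral over [0,
ML]. It stops at the front ct ≤ ML, and y = cs restores the variable s. -/
theorem integral_reflections {L c : ℝ} (hL : 0 < L) (hc : 0 < c) {H : ℝ → ℝ → ℝ}
    (hH : Continuous (Function.uncurry H)) {M : ℕ} {t : ℝ} (ht : 0 ≤ t) (hM : c * t ≤ M * L)
    (n : ℕ) :
    ∫ x in (0 : ℝ)..L, reflections L c H M t x * Real.cos (freq L n * x) =
      ∫ s in (0 : ℝ)..t, H t s * Real.cos (c * freq L n * s) := by
  have hi : ∀ A B, IntervalIntegrable (fun y => front c H t y * Real.cos (freq L n * y)) volume A B :=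
    fun A B => (intervalIntegrable_front hH t A B).mul_continuousOn (by fun_prop)
  have hct : 0 ≤ c * t := by positivity
  calc _ = ∑ k ∈ Finset.range M,
        ∫ x in (0 : ℝ)..L, front c H t (unfolding L k x) * Real.cos (freq L n * unfolding L k x) := by
        simp only [reflections, Finset.sum_mul, cos_freq_unfold hL]
        exact intervalIntegral.integral_finsetSum fun k _ =>
          (intervalIntegrable_front_unfold hH t k).mul_continuousOn (by fun_prop)
    _ = ∑ k ∈ Finset.range M, ∫ y in (k * L : ℝ)..((k + 1 : ℕ) * L : ℝ),
          front c H t y * Real.cos (freq L n * y) :=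
        Finset.sum_congr rfl fun k _ =>
          integral_unfold (fun y => front c H t y * Real.cos (freq L n * y)) k
    _ = ∫ y in (0 : ℝ)..(M * L), front c H t y * Real.cos (freq L n * y) := by
        rw [intervalIntegral.sum_integral_adjacent_intervals (a := fun k : ℕ => (k * L : ℝ))
          fun k _ => hi _ _]
        simp
    _ = ∫ y in (0 : ℝ)..(c * t), front c H t y * Real.cos (freq L n * y) := by
        rw [← intervalIntegral.integral_add_adjacent_intervals (hi 0 (c * t)) (hi _ _)]
        rw [add_eq_left, intervalIntegral.integral_of_le hM]
        refine setIntegral_eq_zero_of_forall_eq_zero fun y hy => ?_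
        rw [front, if_neg (not_le.2 hy.1), zero_mul]
    _ = ∫ y in (0 : ℝ)..(c * t), c⁻¹ * (H t (y / c) * Real.cos (c * freq L n * (y / c))) := by
        refine intervalIntegral.integral_congr fun y hy => ?_
        rw [uIcc_of_le hct] at hy
        simp only [front, if_pos hy.2]
        rw [show c * freq L n * (y / c) = freq L n * y by field_simp]
        ring
    _ = _ := by
        rw [intervalIntegral.integral_const_mul, intervalIntegral.integral_comp_div
          (fun s => H t s * Real.cos (c * freq L n * s)) hc.ne', zero_div,
          mul_div_cancel_left₀ _ hc.ne', smul_eq_mul, inv_mul_cancel_left₀ hc.ne']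

theorem exists_abs_reflections_le {L c : ℝ} (hc : 0 < c) {H : ℝ → ℝ → ℝ}
    (hH : Continuous (Function.uncurry H)) (M : ℕ) (T : ℝ) :
    ∃ C, ∀ t ∈ Icc 0 T, ∀ x ∈ Icc 0 L, |reflections L c H M t x| ≤ C := by
  obtain ⟨B, hB⟩ := (isCompact_Icc.prod isCompact_Icc).exists_bound_of_continuousOn
    (s := Icc 0 T ×ˢ Icc 0 T) hH.continuousOn
  refine ⟨M * (|B| / c), fun t ht x hx => ?_⟩
  refine (Finset.abs_sum_le_sum_abs _ _).trans ?_
  have : ∀ k ∈ Finset.range M, |front c H t (unfolding L k x)| ≤ |B| / c := fun k _ => by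
    unfold front
    split_ifs with h
    · have h0 := unfold_nonneg k hx
      rw [abs_div, abs_of_pos hc]
      refine div_le_div_of_nonneg_right ?_ hc.le
      refine (hB (t, unfolding L k x / c) ⟨ht, by positivity, ?_⟩).trans (le_abs_self B)
      rw [div_le_iff₀ hc, mul_comm]
      exact h.trans (by gcongr; exact ht.2)
    · simp only [abs_zero]; positivity
  refine (Finset.sum_le_card_nsmul _ _ _ this).trans ?_
  simp

/-- The superposed reflections minus their mean: the coefficients with n ≥ 1 do not see a constant,
and zero mean makes the primitive vanish at both ends, as the Dirichlet conditions demand. -/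
theorem exists_profile {L c : ℝ} (hL : 0 < L) (hc : 0 < c) {H : ℝ → ℝ → ℝ}
    (hH : Continuous (Function.uncurry H)) (T : ℝ) :
    ∃ q : ℝ → ℝ → ℝ, Measurable (Function.uncurry q) ∧
      (∃ C, ∀ t ∈ Icc 0 T, ∀ x ∈ Icc 0 L, |q t x| ≤ C) ∧
      (∀ t, IntervalIntegrable (q t) volume 0 L) ∧
      (∀ t, ∃ y, Tendsto (q t) (𝓝[<] L) (𝓝 y)) ∧
      (∀ t, ∫ x in (0 : ℝ)..L, q t x = 0) ∧
      ∀ t ∈ Icc 0 T, ∀ n : ℕ, 1 ≤ n → ∫ x in (0 : ℝ)..L, q t x * Real.cos (freq L n * x) =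
        ∫ s in (0 : ℝ)..t, H t s * Real.cos (c * freq L n * s) := by
  obtain ⟨M, hM⟩ := exists_nat_ge (c * T / L)
  rw [div_le_iff₀ hL] at hM
  set Q := reflections L c H M
  have hQi : ∀ t, IntervalIntegrable (Q t) volume 0 L := intervalIntegrable_reflections hH M
  set mean : ℝ → ℝ := fun t => (∫ x in (0 : ℝ)..L, Q t x) / L with hmean
  have hQm : Measurable (Function.uncurry Q) := measurable_reflections hH M
  obtain ⟨C, hC⟩ := exists_abs_reflections_le (L := L) hc hH M T
  refine ⟨fun t x => Q t x - mean t, ?_, ⟨C + C, fun t ht x hx => ?_⟩, fun t => ?_, fun t => ?_,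
    fun t => ?_, fun t ht n hn => ?_⟩
  · refine hQm.sub (Measurable.comp (g := mean) ?_ measurable_fst)
    refine Measurable.div_const ?_ L
    simp only [intervalIntegral.integral_of_le hL.le]
    exact (hQm.stronglyMeasurable.integral_prod_right (ν := volume.restrict (Ioc 0 L))).measurable
  · refine (abs_sub _ _).trans (add_le_add (hC t ht x hx) ?_)
    rw [hmean, abs_div, abs_of_pos hL, div_le_iff₀ hL]
    have := intervalIntegral.norm_integral_le_of_norm_le_const (a := 0) (b := L) (C := C) (f := Q t)
      fun x hx => hC t ht x (by rw [uIoc_of_le hL.le] at hx; exact Ioc_subset_Icc_self hx)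
    rwa [sub_zero, abs_of_pos hL] at this
  · exact (hQi t).sub intervalIntegrable_const
  · obtain ⟨l, hl⟩ := reflections_left_lim (L := L) (c := c) hH M t
    exact ⟨l - mean t, hl.sub_const _⟩
  · rw [intervalIntegral.integral_sub (hQi t) intervalIntegrable_const,
      intervalIntegral.integral_const, hmean, smul_eq_mul, sub_zero, mul_div_cancel₀ _ hL.ne',
      sub_self]
  · simp only [sub_mul]
    rw [intervalIntegral.integral_sub ((hQi t).mul_continuousOn (by fun_prop))
      ((by fun_prop : Continuous fun x => mean t * Real.cos (freq L n * x)).intervalIntegrable _ _),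
      integral_reflections hL hc hH ht.1 ((by gcongr; exact ht.2 : c * t ≤ c * T).trans hM),
      intervalIntegral.integral_const_mul, sub_eq_self,
      intervalIntegral.integral_comp_mul_left Real.cos (freq_pos hL hn).ne', integral_cos]
    have : freq L n * L = n * Real.pi := by unfold freq; field_simp
    simp [this]

end GurtinPipkin

/-! ### Modes of weak solutions and the flux identity -/

namespace GurtinPipkin

theorem memLp_of_continuous (L : ℝ) {φ : ℝ → ℝ} (hφ : Continuous φ) :
    MemLp φ 2 (volume.restrict (Ioo (0 : ℝ) L)) := by
  obtain ⟨C, hC⟩ := isCompact_Icc.exists_bound_of_continuousOn (s := Icc 0 L) hφ.continuousOn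
  refine MemLp.of_bound hφ.aestronglyMeasurable C ?_
  exact (ae_restrict_iff' measurableSet_Ioo).2
    (Eventually.of_forall fun x hx => hC x (Ioo_subset_Icc_self hx))

/-- The pairing with a continuous function as a bounded functional. -/
def pairingCLM (L : ℝ) {φ : ℝ → ℝ} (hφ : Continuous φ) : L2 L →L[ℝ] ℝ :=
  innerSL ℝ ((memLp_of_continuous L hφ).toLp φ)

theorem pairingCLM_apply {L : ℝ} (hL : 0 ≤ L) {φ : ℝ → ℝ} (hφ : Continuous φ) (u : L2 L) :
    pairingCLM L hφ u = pairing L u φ := by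
  rw [pairingCLM, innerSL_apply_apply, L2.inner_def, pairing, intervalIntegral.integral_of_le hL,
    integral_Ioc_eq_integral_Ioo]
  refine integral_congr_ae ?_
  filter_upwards [(memLp_of_continuous L hφ).coeFn_toLp] with x hx
  rw [hx]
  simp

theorem continuous_eigenfun (L : ℝ) (n : ℕ) : Continuous (eigenfun L n) := by
  unfold eigenfun; fun_prop

theorem deriv_eigenfun (L : ℝ) (n : ℕ) :
    deriv (eigenfun L n) = fun x => gamma0 L * freq L n * Real.cos (freq L n * x) := by
  ext x
  have h : HasDerivAt (fun x => freq L n * x) (freq L n) x := by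
    simpa using (hasDerivAt_id x).const_mul (freq L n)
  have := (h.sin.const_mul (gamma0 L)).deriv
  unfold eigenfun
  rw [this]; ring

theorem deriv_deriv_eigenfun (L : ℝ) (n : ℕ) :
    deriv (deriv (eigenfun L n)) = fun x => -freq L n ^ 2 * eigenfun L n x := by
  rw [deriv_eigenfun]
  ext x
  have h : HasDerivAt (fun x => freq L n * x) (freq L n) x := by
    simpa using (hasDerivAt_id x).const_mul (freq L n)
  rw [(h.cos.const_mul (gamma0 L * freq L n)).deriv, eigenfun]; ring

theorem eigenfun_right {L : ℝ} (hL : 0 < L) (n : ℕ) : eigenfun L n L = 0 := by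
  have : freq L n * L = n * Real.pi := by unfold freq; field_simp
  simp [eigenfun, this]

theorem IsSolution.mode_continuousOn {L : ℝ} (hL : 0 ≤ L) {a β f : ℝ → ℝ} {ξ : L2 L}
    {θ : ℝ → L2 L} (h : IsSolution L a β f ξ θ) (n : ℕ) :
    ContinuousOn (fun t => pairing L (θ t) (eigenfun L n)) (Ici 0) := by
  simp only [← pairingCLM_apply hL (continuous_eigenfun L n)]
  exact (pairingCLM L (continuous_eigenfun L n)).continuous.comp_continuousOn h.continuousOn

theorem intervalIntegrable_volterra {u v : ℝ → ℝ} (hu : ContinuousOn u (Ici 0))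
    (hv : ContinuousOn v (Ici 0)) {t : ℝ} (ht : 0 ≤ t) :
    IntervalIntegrable (fun s => u (t - s) * v s) volume 0 t := by
  refine ContinuousOn.intervalIntegrable ?_
  rw [uIcc_of_le ht]
  exact (hu.comp (by fun_prop) fun s hs => sub_nonneg.2 hs.2).mul (hv.mono Icc_subset_Ici_self)

/-- The weak equation tested with φₙ and integrated in time; the boundary term carries φₙ'(0) =
γ₀λₙ. -/
theorem IsSolution.mode_eq {L : ℝ} (hL : 0 < L) {a β f : ℝ → ℝ} {ξ : L2 L} {θ : ℝ → L2 L}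
    (ha : ContinuousOn a (Ici 0)) (hβ : ContinuousOn β (Ici 0)) (hf : ContinuousOn f (Ici 0))
    (h : IsSolution L a β f ξ θ) (n : ℕ) {t : ℝ} (ht : 0 ≤ t) :
    pairing L (θ t) (eigenfun L n) + volterra β (fun s => pairing L (θ s) (eigenfun L n)) t +
      freq L n ^ 2 * ∫ s in (0 : ℝ)..t, volterra a (fun s => pairing L (θ s) (eigenfun L n)) s =
    pairing L ξ (eigenfun L n) + gamma0 L * freq L n * ∫ s in (0 : ℝ)..t, volterra a f s := by
  have hz := h.mode_continuousOn hL.le n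
  have hsmooth : ContDiff ℝ 2 (eigenfun L n) := by unfold eigenfun; fun_prop
  have hpair : ∀ u : L2 L, pairing L u (deriv (deriv (eigenfun L n))) =
      -freq L n ^ 2 * pairing L u (eigenfun L n) := fun u => by
    rw [deriv_deriv_eigenfun, pairing, pairing, ← intervalIntegral.integral_const_mul]
    exact intervalIntegral.integral_congr fun x _ => by ring
  have hd0 : deriv (eigenfun L n) 0 = gamma0 L * freq L n := by rw [deriv_eigenfun]; simp
  have heq := h.equation (eigenfun L n) hsmooth (by simp [eigenfun]) (eigenfun_right hL n)
  simp only [hpair, hd0] at heq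
  rw [← h.initial]
  set z := fun s => pairing L (θ s) (eigenfun L n) with hzdef
  have hrhs : ∀ s, 0 ≤ s →
      ∫ r in (0 : ℝ)..s, a (s - r) * (-freq L n ^ 2 * z r + f r * (gamma0 L * freq L n)) =
        -freq L n ^ 2 * volterra a z s + gamma0 L * freq L n * volterra a f s := fun s hs => by
    rw [volterra, volterra, ← intervalIntegral.integral_const_mul,
      ← intervalIntegral.integral_const_mul, ← intervalIntegral.integral_add
        ((intervalIntegrable_volterra ha hz hs).const_mul _)
        ((intervalIntegrable_volterra ha hf hs).const_mul _)]
    exact intervalIntegral.integral_congr fun r _ => by ring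
  have hsub : Icc 0 t ⊆ Ici 0 := Icc_subset_Ici_self
  have i1 : IntervalIntegrable (volterra a z) volume 0 t :=
    ((volterra_continuousOn ha hz).mono (by rwa [uIcc_of_le ht])).intervalIntegrable
  have i2 : IntervalIntegrable (volterra a f) volume 0 t :=
    ((volterra_continuousOn ha hf).mono (by rwa [uIcc_of_le ht])).intervalIntegrable
  have hftc := intervalIntegral.integral_eq_sub_of_hasDerivAt_of_le ht
    (f := fun τ => z τ + volterra β z τ)
    (f' := fun s => -freq L n ^ 2 * volterra a z s + gamma0 L * freq L n * volterra a f s)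
    ((hz.add (volterra_continuousOn hβ hz)).mono hsub)
    (fun s hs => by
      have := (heq s hs.1.le).hasDerivAt (Ici_mem_nhds hs.1)
      rwa [hrhs s hs.1.le] at this)
    ((i1.const_mul _).add (i2.const_mul _))
  rw [intervalIntegral.integral_add (i1.const_mul _) (i2.const_mul _),
    intervalIntegral.integral_const_mul, intervalIntegral.integral_const_mul] at hftc
  have h0 : volterra β z 0 = 0 := by simp [volterra]
  simp only [hzdef] at hftc ⊢
  linarith

theorem IsSolution.pairing_relaxed {L : ℝ} (hL : 0 ≤ L) {a β f : ℝ → ℝ} {ξ : L2 L}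
    {θ : ℝ → L2 L} (ha : ContinuousOn a (Ici 0)) (h : IsSolution L a β f ξ θ) (n : ℕ) {t : ℝ}
    (ht : 0 ≤ t) : pairing L (relaxed L a θ t) (eigenfun L n) =
      volterra a (fun s => pairing L (θ s) (eigenfun L n)) t := by
  rw [← pairingCLM_apply hL (continuous_eigenfun L n), relaxed,
    ← ContinuousLinearMap.intervalIntegral_comp_comm]
  · simp only [map_smul, smul_eq_mul]
    simp only [pairingCLM_apply hL (continuous_eigenfun L n)]
    rfl
  · refine ContinuousOn.intervalIntegrable ?_
    rw [uIcc_of_le ht]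
    exact (ha.comp (by fun_prop) fun s hs => sub_nonneg.2 hs.2).smul
      (h.continuousOn.mono Icc_subset_Ici_self)

theorem gamma0_pos {L : ℝ} (hL : 0 < L) : 0 < gamma0 L := Real.sqrt_pos.2 (by positivity)

theorem gamma0_sq {L : ℝ} (hL : 0 < L) : gamma0 L ^ 2 * L = 2 := by
  rw [gamma0, Real.sq_sqrt (by positivity)]; field_simp

theorem integrableOn_L2 {L : ℝ} (u : L2 L) : IntegrableOn u (Ioo 0 L) :=
  (Lp.memLp u).integrable one_le_two

theorem ae_eq_of_pairing_eigenfun {L : ℝ} (hL : 0 < L) {u : L2 L} {q : ℝ → ℝ}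
    (hq : IntervalIntegrable q volume 0 L)
    (h : ∀ n : ℕ, 1 ≤ n → freq L n * pairing L u (eigenfun L n) =
      gamma0 L * ((∫ x in (0 : ℝ)..L, q x) - ∫ x in (0 : ℝ)..L, q x * Real.cos (freq L n * x))) :
    ∀ᵐ x ∂(volume.restrict (Ioo (0 : ℝ) L)),
      u x = (∫ x' in (0 : ℝ)..L, q x') - ∫ x' in (0 : ℝ)..x, q x' := by
  refine ae_eq_of_sine_coeffs hL (integrableOn_L2 u)
    ((intervalIntegrable_iff_integrableOn_Ioo_of_le hL.le).1 hq) fun n hn => ?_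
  refine mul_left_cancel₀ (gamma0_pos hL).ne' ?_
  rw [← h n hn, pairing]
  simp only [eigenfun, mul_left_comm _ (gamma0 L)]
  rw [intervalIntegral.integral_const_mul]
  ring

theorem exists_interior_profile {L : ℝ} (hL : 0 < L) {a β : ℝ → ℝ}
    (ha : ContDiffOn ℝ 2 a (Ici 0)) (hβ : ContDiffOn ℝ 2 β (Ici 0)) (ha0 : 0 < a 0)
    {ξ : L2 L} (hξ : ∀ n : ℕ, 1 ≤ n → pairing L ξ (eigenfun L n) = 1 / freq L n)
    {θ : ℝ → L2 L} (hθ : IsSolution L a β (fun _ => 0) ξ θ) (T : ℝ≥0) :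
    ∃ q : ℝ → ℝ → ℝ, Measurable (Function.uncurry q) ∧
      (∃ C, ∀ t ∈ Icc (0 : ℝ) T, ∀ x ∈ Icc 0 L, |q t x| ≤ C) ∧
      (∀ t, IntervalIntegrable (q t) volume 0 L) ∧
      (∀ t, ∃ y, Tendsto (q t) (𝓝[<] L) (𝓝 y)) ∧
      (∀ t, ∫ x in (0 : ℝ)..L, q t x = 0) ∧
      (∀ t ∈ Icc (0 : ℝ) T, ∀ n : ℕ, 1 ≤ n →
        freq L n * volterra a (fun s => pairing L (θ s) (eigenfun L n)) t =
          -gamma0 L * ∫ x in (0 : ℝ)..L, q t x * Real.cos (freq L n * x)) ∧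
      ∀ t ∈ Icc (0 : ℝ) T, ∀ y, Tendsto (q t) (𝓝[<] L) (𝓝 y) → IsFluxAtRight L a θ t y := by
  obtain ⟨H, hH, hHeq⟩ := exists_mode_transmutation ha hβ ha0 T
  have hγ := gamma0_pos hL
  -- The factor -1/γ₀ absorbs the normalization of φₙ and the sign in q = -∂ₓw.
  obtain ⟨q, hqm, hqb, hqi, hql, hq0, hqc⟩ := exists_profile hL (Real.sqrt_pos.2 ha0)
    (H := fun t s => -(gamma0 L)⁻¹ * H t s)
    (by simpa only [Function.uncurry_def] using hH.const_mul (-(gamma0 L)⁻¹)) T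
  have hmode : ∀ t ∈ Icc (0 : ℝ) T, ∀ n : ℕ, 1 ≤ n →
      freq L n * volterra a (fun s => pairing L (θ s) (eigenfun L n)) t =
        -gamma0 L * ∫ x in (0 : ℝ)..L, q t x * Real.cos (freq L n * x) := fun t ht n hn => by
    have hn0 := freq_pos hL hn
    have hz := hθ.mode_continuousOn hL.le n
    -- Multiplying the mode by λₙ turns its initial value 1/λₙ into 1, the same for every n.
    have key := hHeq (freq L n) (fun s => freq L n * pairing L (θ s) (eigenfun L n))
      (continuousOn_const.mul hz) (fun s hs => ?_) t ht
    · rw [hqc t ht n hn]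
      simp only [mul_assoc, intervalIntegral.integral_const_mul]
      simp only [← mul_assoc]
      rw [neg_mul_neg, mul_inv_cancel₀ hγ.ne', one_mul, ← key, volterra_smul_right]
    · have := hθ.mode_eq hL ha.continuousOn hβ.continuousOn continuousOn_const n hs.1
      rw [hξ n hn] at this
      have h0 : ∀ r, volterra a (fun _ => 0) r = 0 := fun r => by simp [volterra]
      simp only [h0, intervalIntegral.integral_zero, mul_zero, add_zero] at this
      simp only [volterra_smul_right, intervalIntegral.integral_const_mul]
      rw [eq_div_iff hn0.ne'] at this
      linarith
  refine ⟨q, hqm, hqb, hqi, hql, hq0, hmode, fun t ht y hy => ?_⟩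
  refine ⟨q t, (intervalIntegrable_iff_integrableOn_Ioo_of_le hL.le).1 (hqi t),
    ⟨_, ae_eq_of_pairing_eigenfun hL (hqi t) fun n hn => ?_⟩, hy⟩
  rw [hθ.pairing_relaxed hL.le ha.continuousOn n ht.1, hmode t ht n hn, hq0]
  ring

section Convolution

variable {L C t : ℝ} {q : ℝ → ℝ → ℝ} {h : ℝ → ℝ}

theorem integrable_conv_profile (hqm : Measurable (Function.uncurry q))
    (hqb : ∀ s ∈ Icc (0 : ℝ) t, ∀ x ∈ Icc 0 L, |q s x| ≤ C) (hh : Continuous h)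
    {κ : ℝ → ℝ} (hκ : Continuous κ) :
    Integrable (Function.uncurry fun s x => h (t - s) * q s x * κ x)
      ((volume.restrict (Ioc 0 t)).prod (volume.restrict (Ioc 0 L))) := by
  have hc : Continuous fun p : ℝ × ℝ => h (t - p.1) * κ p.2 := by fun_prop
  have h1 : Integrable (fun p : ℝ × ℝ => h (t - p.1) * κ p.2)
      ((volume.restrict (Ioc 0 t)).prod (volume.restrict (Ioc 0 L))) := by
    rw [Measure.prod_restrict]
    exact (hc.continuousOn.integrableOn_compact (isCompact_Icc.prod isCompact_Icc)).mono_set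
      (prod_mono Ioc_subset_Icc_self Ioc_subset_Icc_self)
  have h2 := h1.bdd_mul (c := C) hqm.aestronglyMeasurable (by
    rw [Measure.prod_restrict]
    exact (ae_restrict_iff' (measurableSet_Ioc.prod measurableSet_Ioc)).2
      (Eventually.of_forall fun p hp =>
        hqb p.1 (Ioc_subset_Icc_self hp.1) p.2 (Ioc_subset_Icc_self hp.2)))
  refine h2.congr (Eventually.of_forall fun p => ?_)
  simp only [Function.uncurry_def]
  ring

theorem intervalIntegrable_conv_profile (hL : 0 ≤ L) (ht : 0 ≤ t)
    (hqm : Measurable (Function.uncurry q))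
    (hqb : ∀ s ∈ Icc (0 : ℝ) t, ∀ x ∈ Icc 0 L, |q s x| ≤ C) (hh : Continuous h) :
    IntervalIntegrable (fun x => ∫ s in (0 : ℝ)..t, h (t - s) * q s x) volume 0 L := by
  have := (integrable_conv_profile hqm hqb hh (continuous_const (y := (1 : ℝ)))).integral_prod_right
  rw [intervalIntegrable_iff_integrableOn_Ioc_of_le hL, IntegrableOn]
  simpa only [intervalIntegral.integral_of_le ht, Function.uncurry_def, mul_one] using this

theorem integral_conv_profile (hL : 0 ≤ L) (ht : 0 ≤ t) (hqm : Measurable (Function.uncurry q))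
    (hqb : ∀ s ∈ Icc (0 : ℝ) t, ∀ x ∈ Icc 0 L, |q s x| ≤ C) (hh : Continuous h)
    {κ : ℝ → ℝ} (hκ : Continuous κ) :
    ∫ x in (0 : ℝ)..L, (∫ s in (0 : ℝ)..t, h (t - s) * q s x) * κ x =
      ∫ s in (0 : ℝ)..t, h (t - s) * ∫ x in (0 : ℝ)..L, q s x * κ x := by
  have := integral_integral_swap (integrable_conv_profile hqm hqb hh hκ)
  simp only [← intervalIntegral.integral_of_le hL, ← intervalIntegral.integral_of_le ht,
    intervalIntegral.integral_mul_const] at this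
  rw [← this]
  simp only [mul_assoc, intervalIntegral.integral_const_mul]

/-- Dominated convergence; the uniform bound on q is what the reflection construction supplies. -/
theorem tendsto_conv_profile (hL : 0 < L) (ht : 0 ≤ t) (hqm : Measurable (Function.uncurry q))
    (hqb : ∀ s ∈ Icc (0 : ℝ) t, ∀ x ∈ Icc 0 L, |q s x| ≤ C) (hh : Continuous h)
    {K : ℝ → ℝ} (hK : ∀ s ∈ Icc 0 t, Tendsto (q s) (𝓝[<] L) (𝓝 (K s))) :
    Tendsto (fun x => ∫ s in (0 : ℝ)..t, h (t - s) * q s x) (𝓝[<] L)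
      (𝓝 (∫ s in (0 : ℝ)..t, h (t - s) * K s)) := by
  refine intervalIntegral.tendsto_integral_filter_of_dominated_convergence
    (fun s => |h (t - s)| * C) (Eventually.of_forall fun x => ?_) ?_ ?_ ?_
  · have h1 : Measurable fun s => q s x := hqm.comp (measurable_id.prodMk measurable_const)
    exact ((by fun_prop : Continuous fun s => h (t - s)).measurable.mul h1).aestronglyMeasurable
  · filter_upwards [Ioo_mem_nhdsLT hL] with x hx
    refine Eventually.of_forall fun s hs => ?_
    rw [uIoc_of_le ht] at hs
    rw [norm_mul]
    exact mul_le_mul_of_nonneg_left (hqb s (Ioc_subset_Icc_self hs) x (Ioo_subset_Icc_self hx))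
      (norm_nonneg _)
  · exact (by fun_prop : Continuous fun s => |h (t - s)| * C).intervalIntegrable _ _
  · refine Eventually.of_forall fun s hs => ?_
    rw [uIoc_of_le ht] at hs
    exact (hK s (Ioc_subset_Icc_self hs)).const_mul _

theorem intervalIntegrable_of_profile (hL : 0 < L) (ht : 0 ≤ t)
    (hqm : Measurable (Function.uncurry q))
    (hqb : ∀ s ∈ Icc (0 : ℝ) t, ∀ x ∈ Icc 0 L, |q s x| ≤ C)
    {K : ℝ → ℝ} (hK : ∀ s ∈ Icc 0 t, Tendsto (q s) (𝓝[<] L) (𝓝 (K s))) :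
    IntervalIntegrable K volume 0 t := by
  rw [intervalIntegrable_iff_integrableOn_Ioc_of_le ht]
  have hlim : ∀ᵐ s ∂(volume.restrict (Ioc 0 t)), Tendsto (fun x => q s x) (𝓝[<] L) (𝓝 (K s)) :=
    (ae_restrict_iff' measurableSet_Ioc).2
      (Eventually.of_forall fun s hs => hK s (Ioc_subset_Icc_self hs))
  refine Integrable.of_bound (aestronglyMeasurable_of_tendsto_ae (𝓝[<] L)
    (f := fun x s => q s x) (fun x => ?_) hlim) C ?_
  · have h1 : Measurable fun s => q s x := hqm.comp (measurable_id.prodMk measurable_const)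
    exact h1.aestronglyMeasurable
  · refine (ae_restrict_iff' measurableSet_Ioc).2 (Eventually.of_forall fun s hs => ?_)
    refine le_of_tendsto (hK s (Ioc_subset_Icc_self hs)).norm ?_
    filter_upwards [Ioo_mem_nhdsLT hL] with x hx
    exact hqb s (Ioc_subset_Icc_self hs) x (Ioo_subset_Icc_self hx)

end Convolution

theorem fluxFormula_eq (L : ℝ) (β g K b : ℝ → ℝ) (t : ℝ) :
    fluxFormula L β g K b t = gamma0 L * (gamma0 L / 2 * volterra b (primitive g) t
      - volterra (hfun β g) K t) := by
  rw [volterra_comm b]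
  simp only [fluxFormula, volterra, primitive, mul_comm]

/-- The density for θ^f is written down from the interior profile and verified mode by mode through
`mode_boundary_eq`; its limit at L is the flux formula. -/
theorem isFluxAtRight_boundary {L : ℝ} (hL : 0 < L) {a β g : ℝ → ℝ}
    (ha : ContDiffOn ℝ 2 a (Ici 0)) (hβ : ContDiffOn ℝ 2 β (Ici 0)) (ha0 : 0 < a 0)
    (hg : ContinuousOn g (Ici 0)) {ξ : L2 L}
    (hξ : ∀ n : ℕ, 1 ≤ n → pairing L ξ (eigenfun L n) = 1 / freq L n) {θξ θf : ℝ → L2 L}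
    (hθξ : IsSolution L a β (fun _ => 0) ξ θξ) (hθf : IsSolution L a β (primitive g) 0 θf)
    {K : ℝ → ℝ} (hK : ∀ t, 0 ≤ t → ∀ y, IsFluxAtRight L a θξ t y ↔ y = K t) {t : ℝ}
    (ht : 0 ≤ t) :
    IntervalIntegrable K volume 0 t ∧ IsFluxAtRight L a θf t (fluxFormula L β g K a t) := by
  lift t to ℝ≥0 using ht with T
  have ht : (0 : ℝ) ≤ T := T.2
  obtain ⟨q, hqm, ⟨C, hqb⟩, hqi, hql, hq0, hqc, hqf⟩ :=
    exists_interior_profile hL ha hβ ha0 hξ hθξ T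
  -- The profile depends on the horizon T, but K does not: uniqueness of the flux identifies its
  -- boundary limits with K.
  have hlim : ∀ s ∈ Icc (0 : ℝ) T, Tendsto (q s) (𝓝[<] L) (𝓝 (K s)) := fun s hs => by
    obtain ⟨y, hy⟩ := hql s
    rwa [← (hK s hs.1 y).1 (hqf s hs y hy)]
  refine ⟨intervalIntegrable_of_profile hL ht hqm hqb hlim, ?_⟩
  have hhc := hfun_continuousOn hβ.continuousOn hg
  set h : ℝ → ℝ := fun s => hfun β g (max s 0)
  have hh : Continuous h := hhc.comp_continuous (by fun_prop) fun s => le_max_right s 0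
  have hh' : ∀ v : ℝ → ℝ, ∫ s in (0 : ℝ)..T, h (T - s) * v s = volterra (hfun β g) v T := fun v =>
    volterra_congr ht (fun s hs => by simp only [h, max_eq_left hs.1]) fun _ _ => rfl
  have hconv := intervalIntegrable_conv_profile hL.le ht hqm hqb hh
  set A := volterra a (primitive g) T
  have hqi' : IntervalIntegrable (fun x => gamma0 L * (gamma0 L / 2 * A -
      ∫ s in (0 : ℝ)..T, h (T - s) * q s x)) volume 0 L :=
    (intervalIntegrable_const.sub hconv).const_mul _
  refine ⟨fun x => gamma0 L * (gamma0 L / 2 * A - ∫ s in (0 : ℝ)..T, h (T - s) * q s x),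
    (intervalIntegrable_iff_integrableOn_Ioo_of_le hL.le).1 hqi',
    ⟨_, ae_eq_of_pairing_eigenfun hL hqi' fun n hn => ?_⟩, ?_⟩
  · have hn0 := freq_pos hL hn
    have hcos : Continuous fun x => Real.cos (freq L n * x) := by fun_prop
    -- Because γ₀²L/2 = 1 and q has zero mean, the density has integral A, the relaxed boundary
    -- temperature at x = 0.
    have i0 : ∫ x in (0 : ℝ)..L, gamma0 L * (gamma0 L / 2 * A -
        ∫ s in (0 : ℝ)..T, h (T - s) * q s x) = A := by
      have e := integral_conv_profile hL.le ht hqm hqb hh (continuous_const (y := (1 : ℝ)))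
      simp only [mul_one, hq0, mul_zero, intervalIntegral.integral_zero] at e
      rw [intervalIntegral.integral_const_mul, intervalIntegral.integral_sub
        intervalIntegrable_const hconv, e, intervalIntegral.integral_const, smul_eq_mul, sub_zero,
        sub_zero]
      linear_combination A / 2 * gamma0_sq hL
    have i1 : ∫ x in (0 : ℝ)..L, gamma0 L * (gamma0 L / 2 * A -
        ∫ s in (0 : ℝ)..T, h (T - s) * q s x) * Real.cos (freq L n * x) =
        freq L n * volterra (hfun β g)
          (volterra a fun s => pairing L (θξ s) (eigenfun L n)) T := by
      have e := integral_conv_profile hL.le ht hqm hqb hh hcos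
      have e2 : ∫ x in (0 : ℝ)..L, Real.cos (freq L n * x) = 0 := by
        rw [intervalIntegral.integral_comp_mul_left Real.cos hn0.ne', integral_cos]
        have : freq L n * L = n * Real.pi := by unfold freq; field_simp
        simp [this]
      simp only [mul_assoc (gamma0 L), sub_mul]
      rw [intervalIntegral.integral_const_mul, intervalIntegral.integral_sub
        ((by fun_prop : Continuous fun x => gamma0 L / 2 * A * Real.cos (freq L n * x)
          ).intervalIntegrable _ _) (hconv.mul_continuousOn hcos.continuousOn), e,
        intervalIntegral.integral_const_mul, e2, mul_zero, zero_sub, hh', ← volterra_smul_right,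
        mul_neg, ← neg_mul, ← volterra_smul_right]
      exact volterra_congr ht (fun _ _ => rfl) fun s hs => (hqc s hs n hn).symm
    rw [i0, i1, hθf.pairing_relaxed hL.le ha.continuousOn n ht,
      mode_boundary_eq (γ := gamma0 L) (μ := freq L n) (ξ := 1 / freq L n) ha.continuousOn
        hβ.continuousOn hg (hθξ.mode_continuousOn hL.le n) (hθf.mode_continuousOn hL.le n)
        (mul_one_div_cancel hn0.ne') (fun s hs => ?_) (fun s hs => ?_) ht]
    · field_simp
      ring
    · have := hθξ.mode_eq hL ha.continuousOn hβ.continuousOn continuousOn_const n hs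
      have h0 : ∀ r, volterra a (fun _ => 0) r = 0 := fun r => by simp [volterra]
      rw [this, hξ n hn]
      simp [h0]
    · have := hθf.mode_eq hL ha.continuousOn hβ.continuousOn (primitive_continuousOn hg) n hs
      have h0 : pairing L 0 (eigenfun L n) = 0 := by
        rw [← pairingCLM_apply hL.le (continuous_eigenfun L n), map_zero]
      rwa [h0, zero_add] at this
  · rw [fluxFormula_eq, ← hh']
    exact ((tendsto_conv_profile hL ht hqm hqb hh hlim).const_sub _).const_mul _

end GurtinPipkin

/-! ### Titchmarsh's convolution theorem -/

/-- In the square of the integral over [0, 2T], the part r + s ≤ 2T vanishes because f ∗ f does. On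
the rest e^{-x(r+s)} ≤ e^{-2xT}, so the root is at most 2TA e^{-xT}; the piece over [T, 2T] costs
another TA e^{-xT}. -/
theorem abs_integral_exp_le_of_volterra_self {f : ℝ → ℝ} (hf : Continuous f) {T A : ℝ} (hT : 0 ≤ T)
    (hA : ∀ s ∈ Icc 0 (2 * T), |f s| ≤ A) (h : ∀ t ∈ Icc 0 (2 * T), volterra f f t = 0) {x : ℝ}
    (hx : 0 ≤ x) :
    |∫ s in (0 : ℝ)..T, Real.exp (-x * s) * f s| ≤ 3 * T * A * Real.exp (-x * T) := by
  have hA0 : 0 ≤ A := (abs_nonneg _).trans (hA 0 ⟨le_rfl, by linarith⟩)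
  set φ : ℝ → ℝ := fun s => Real.exp (-x * s) * f s with hφ
  have hφc : Continuous φ := by fun_prop
  have hφi : ∀ a b, IntervalIntegrable φ volume a b := fun a b => hφc.intervalIntegrable a b
  have h2T : 0 ≤ 2 * T := by linarith
  have hφb : ∀ s ∈ Icc 0 (2 * T), |φ s| ≤ Real.exp (-x * s) * A := fun s hs => by
    rw [hφ, abs_mul, Real.abs_exp]
    exact mul_le_mul_of_nonneg_left (hA s hs) (Real.exp_pos _).le
  have hzero : ∫ s in (0 : ℝ)..(2 * T), ∫ τ in s..(2 * T), φ (τ - s) * φ s = 0 := by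
    rw [← integral_triangle_swap (F := fun τ s => φ (τ - s) * φ s)
      (by simp only [Function.uncurry_def]; fun_prop) h2T]
    refine (intervalIntegral.integral_congr (g := fun _ => (0 : ℝ)) fun τ hτ => ?_).trans (by simp)
    rw [uIcc_of_le h2T] at hτ
    have : ∀ s, φ (τ - s) * φ s = Real.exp (-x * τ) * (f (τ - s) * f s) := fun s => by
      simp only [hφ]
      rw [show -x * τ = -x * (τ - s) + -x * s by ring, Real.exp_add]; ring
    simp only [this, intervalIntegral.integral_const_mul]
    have := h τ hτ
    rw [volterra] at this
    rw [this, mul_zero]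
  have hsq : (∫ s in (0 : ℝ)..(2 * T), φ s) ^ 2 =
      ∫ s in (0 : ℝ)..(2 * T), (∫ r in (2 * T - s)..(2 * T), φ r) * φ s := by
    have e1 : ∀ s, ∫ τ in s..(2 * T), φ (τ - s) * φ s = (∫ r in (0 : ℝ)..(2 * T - s), φ r) * φ s :=
      fun s => by
        rw [intervalIntegral.integral_mul_const, intervalIntegral.integral_comp_sub_right, sub_self]
    simp only [e1] at hzero
    refine (Eq.trans ?_ (congrArg (_ - ·) hzero.symm)).trans
      ((intervalIntegral.integral_sub (f := fun s => (∫ s in (0 : ℝ)..(2 * T), φ s) * φ s)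
        ?_ ?_).symm.trans ?_)
    · rw [intervalIntegral.integral_const_mul, sub_zero, sq]
    · exact (by fun_prop : Continuous fun s => (∫ s in (0 : ℝ)..(2 * T), φ s) * φ s
        ).intervalIntegrable _ _
    · have : Continuous fun s => ∫ r in (0 : ℝ)..(2 * T - s), φ r :=
        (intervalIntegral.continuous_primitive hφi 0).comp (by fun_prop)
      exact (this.mul hφc).intervalIntegrable _ _
    · refine intervalIntegral.integral_congr fun s _ => ?_
      rw [← intervalIntegral.integral_add_adjacent_intervals (hφi 0 (2 * T - s)) (hφi _ (2 * T))]
      ring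
  have hbound : (∫ s in (0 : ℝ)..(2 * T), φ s) ^ 2 ≤ (2 * T * A * Real.exp (-x * T)) ^ 2 := by
    rw [hsq]
    refine (le_abs_self _).trans ?_
    rw [← Real.norm_eq_abs]
    refine (intervalIntegral.norm_integral_le_of_norm_le_const
      (C := 2 * T * A ^ 2 * Real.exp (-x * T) ^ 2) fun s hs => ?_).trans_eq ?_
    · rw [uIoc_of_le h2T] at hs
      have hs0 : 0 ≤ s := hs.1.le
      have hi : ‖∫ r in (2 * T - s)..(2 * T), φ r‖ ≤
          Real.exp (-x * (2 * T - s)) * A * |2 * T - (2 * T - s)| := by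
        refine intervalIntegral.norm_integral_le_of_norm_le_const fun r hr => ?_
        rw [uIoc_of_le (by linarith)] at hr
        refine (hφb r ⟨by linarith [hr.1, hs.2], hr.2⟩).trans ?_
        refine mul_le_mul_of_nonneg_right (Real.exp_le_exp.2 ?_) hA0
        nlinarith [hr.1]
      rw [sub_sub_cancel, abs_of_nonneg hs0] at hi
      rw [norm_mul]
      calc _ ≤ (Real.exp (-x * (2 * T - s)) * A * s) * (Real.exp (-x * s) * A) :=
            mul_le_mul hi (hφb s (Ioc_subset_Icc_self hs)) (abs_nonneg _) (by positivity)
        _ = s * A ^ 2 * Real.exp (-x * T) ^ 2 := by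
            rw [sq (Real.exp (-x * T)), ← Real.exp_add,
              show -x * T + -x * T = -x * (2 * T - s) + -x * s by ring, Real.exp_add]
            ring
        _ ≤ _ := by gcongr; exact hs.2
    · rw [sub_zero, abs_of_nonneg h2T]; ring
  have h1 := abs_le_of_sq_le_sq hbound (by positivity)
  have h2 : ‖∫ s in T..(2 * T), φ s‖ ≤ Real.exp (-x * T) * A * |2 * T - T| := by
    refine intervalIntegral.norm_integral_le_of_norm_le_const fun r hr => ?_
    rw [uIoc_of_le (by linarith)] at hr
    refine (hφb r ⟨by linarith [hr.1], hr.2⟩).trans ?_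
    refine mul_le_mul_of_nonneg_right (Real.exp_le_exp.2 ?_) hA0
    nlinarith [hr.1]
  rw [Real.norm_eq_abs, show 2 * T - T = T by ring, abs_of_nonneg hT] at h2
  rw [← intervalIntegral.integral_add_adjacent_intervals (hφi 0 T) (hφi T (2 * T))] at h1
  have h3 := abs_le.1 h2
  have h4 := abs_le.1 h1
  rw [abs_le]
  constructor <;> linarith [h4.1, h4.2, h3.1, h3.2]

theorem eq_zero_of_integral_exp_eq_zero {f : ℝ → ℝ} (hf : Continuous f) {T : ℝ} (hT : 0 ≤ T)
    (h : ∀ k : ℕ, ∫ s in (0 : ℝ)..T, f s * Real.exp (-s) ^ k = 0) {t : ℝ} (ht : t ∈ Ioo 0 T) :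
    f t = 0 := by
  have h1 : ∀ᵐ x ∂(volume.restrict (Ioo (0 : ℝ) T)), f x = 0 := by
    refine ae_eq_zero_of_integral_continuous_mul hT
      ((hf.integrableOn_Icc (a := 0) (b := T)).mono_set Ioo_subset_Icc_self) fun ψ hψ => ?_
    refine integral_mul_eq_zero_of_polynomial (A := Real.exp (-T)) (B := 1) hT
      (hf.intervalIntegrable _ _) (θ := fun s => Real.exp (-s)) (χ := fun y => ψ (-Real.log y))
      (by fun_prop) hψ ?_ (fun s hs => ⟨?_, ?_⟩) (fun s _ => ?_) h
    · refine hψ.comp_continuousOn (ContinuousOn.neg (Real.continuousOn_log.mono fun y hy => ?_))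
      exact ((Real.exp_pos _).trans_le hy.1).ne'
    · exact Real.exp_le_exp.2 (by linarith [hs.2])
    · exact Real.exp_le_one_iff.2 (by linarith [hs.1])
    · simp
  exact Measure.eqOn_open_of_ae_eq (g := fun _ => (0 : ℝ)) h1 isOpen_Ioo hf.continuousOn
    continuousOn_const ht

theorem differentiable_integral_cexp {f : ℝ → ℝ} (hf : Continuous f) {T : ℝ} :
    Differentiable ℂ fun z : ℂ => ∫ s in (0 : ℝ)..T, Complex.exp (z * ((T - s : ℝ) : ℂ)) * f s := by
  intro z₀
  set F' : ℂ → ℝ → ℂ := fun z s =>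
    Complex.exp (z * ((T - s : ℝ) : ℂ)) * ((T - s : ℝ) : ℂ) * f s with hF'
  have hF'c : Continuous (Function.uncurry F') := by
    simp only [hF', Function.uncurry_def]; fun_prop
  obtain ⟨C, hC⟩ := ((isCompact_closedBall z₀ 1).prod (isCompact_uIcc (a := 0) (b := T))
    ).exists_bound_of_continuousOn hF'c.continuousOn
  refine (intervalIntegral.hasDerivAt_integral_of_dominated_loc_of_deriv_le (μ := volume)
    (F := fun z s => Complex.exp (z * ((T - s : ℝ) : ℂ)) * f s) (F' := F') (bound := fun _ => C)
    (Metric.ball_mem_nhds z₀ one_pos) (Eventually.of_forall fun z => ?_) ?_ ?_ ?_ ?_ ?_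
    ).2.differentiableAt
  · exact (by fun_prop : Continuous fun s : ℝ => Complex.exp (z * ((T - s : ℝ) : ℂ)) * f s
      ).aestronglyMeasurable
  · exact (by fun_prop : Continuous fun s : ℝ => Complex.exp (z₀ * ((T - s : ℝ) : ℂ)) * f s
      ).intervalIntegrable _ _
  · exact (hF'c.comp (by fun_prop : Continuous fun s : ℝ => (z₀, s))).aestronglyMeasurable
  · exact Eventually.of_forall fun s hs z hz =>
      hC (z, s) ⟨Metric.ball_subset_closedBall hz, uIoc_subset_uIcc hs⟩
  · exact intervalIntegrable_const
  · refine Eventually.of_forall fun s _ z _ => ?_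
    have h1 : HasDerivAt (fun z : ℂ => z * ((T - s : ℝ) : ℂ)) ((T - s : ℝ) : ℂ) z := by
      simpa using (hasDerivAt_id z).mul_const ((T - s : ℝ) : ℂ)
    exact h1.cexp.mul_const _

theorem norm_integral_cexp_le {f : ℝ → ℝ} {T A : ℝ} (hT : 0 ≤ T)
    (hA : ∀ s ∈ Icc 0 T, |f s| ≤ A) {z : ℂ} {r : ℝ} (hz : ∀ u ∈ Icc 0 T, z.re * u ≤ r) :
    ‖∫ s in (0 : ℝ)..T, Complex.exp (z * ((T - s : ℝ) : ℂ)) * f s‖ ≤ Real.exp r * A * T := by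
  have := intervalIntegral.norm_integral_le_of_norm_le_const (a := 0) (b := T)
    (C := Real.exp r * A) (f := fun s : ℝ => Complex.exp (z * ((T - s : ℝ) : ℂ)) * f s)
    fun s hs => ?_
  · rwa [sub_zero, abs_of_nonneg hT] at this
  rw [uIoc_of_le hT] at hs
  rw [norm_mul, Complex.norm_exp, Complex.re_mul_ofReal, Complex.norm_real]
  refine mul_le_mul (Real.exp_le_exp.2 (hz _ ⟨by linarith [hs.2], by linarith [hs.1]⟩))
    (hA s (Ioc_subset_Icc_self hs)) (norm_nonneg _) (Real.exp_pos _).le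

/-- The entire function G(z) = ∫₀ᵀ e^{z(T-s)} f(s) ds is bounded, hence constant. Its decay along
the negative axis makes the constant 0, and then all exponential moments of f vanish. -/
theorem eq_zero_of_volterra_self {f : ℝ → ℝ} (hf : Continuous f) {T : ℝ} (hT : 0 ≤ T)
    (h : ∀ t ∈ Icc 0 (2 * T), volterra f f t = 0) {t : ℝ} (ht : t ∈ Ioo 0 T) : f t = 0 := by
  obtain ⟨A, hA⟩ := (isCompact_Icc (a := (0 : ℝ)) (b := 2 * T)).exists_bound_of_continuousOn
    hf.continuousOn
  have hA0 : 0 ≤ A := (norm_nonneg _).trans (hA 0 ⟨le_rfl, by linarith⟩)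
  have hA' : ∀ s ∈ Icc 0 T, |f s| ≤ A := fun s hs => hA s ⟨hs.1, by linarith [hs.2]⟩
  set G : ℂ → ℂ := fun z => ∫ s in (0 : ℝ)..T, Complex.exp (z * ((T - s : ℝ) : ℂ)) * f s with hG
  have hGd : Differentiable ℂ G := differentiable_integral_cexp hf
  have hreal : ∀ x : ℝ, G x = ((Real.exp (x * T) * ∫ s in (0 : ℝ)..T, Real.exp (-x * s) * f s : ℝ) : ℂ) :=
    fun x => by
      rw [hG, ← intervalIntegral.integral_const_mul, ← intervalIntegral.integral_ofReal]
      refine intervalIntegral.integral_congr fun s _ => ?_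
      rw [← mul_assoc, ← Real.exp_add, show x * T + -x * s = x * (T - s) by ring]
      push_cast
      rfl
  have hleft : ∀ z : ℂ, z.re ≤ 0 → ‖G z‖ ≤ A * T := fun z hz => by
    have := norm_integral_cexp_le hT hA' (z := z) (r := 0)
      fun u hu => mul_nonpos_of_nonpos_of_nonneg hz hu.1
    rwa [Real.exp_zero, one_mul] at this
  -- Phragmén-Lindelöf in the right half-plane: G has exponential type, is bounded on the imaginary
  -- axis by the left half-plane estimate, and on the positive axis by the preceding lemma.
  have hright : ∀ z : ℂ, 0 ≤ z.re → ‖G z‖ ≤ A * T := fun z hz => by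
    refine PhragmenLindelof.right_half_plane_of_bounded_on_real hGd.diffContOnCl
      ⟨1, by norm_num, T, ?_⟩ ?_ (fun x => hleft _ (by simp)) hz
    · refine Asymptotics.IsBigO.of_bound (A * T) (Eventually.of_forall fun w => ?_)
      have := norm_integral_cexp_le hT hA' (z := w) (r := T * ‖w‖) fun u hu => by
        rw [mul_comm T]
        exact mul_le_mul (Complex.re_le_norm w) hu.2 hu.1 (norm_nonneg _)
      rw [Real.rpow_one, Real.norm_eq_abs, Real.abs_exp]
      linarith
    · refine ⟨3 * T * A, eventually_map.2 ?_⟩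
      filter_upwards [eventually_ge_atTop 0] with x hx
      rw [hreal, Complex.norm_real, norm_mul, Real.norm_eq_abs, Real.abs_exp]
      have := abs_integral_exp_le_of_volterra_self hf hT hA h hx
      calc _ ≤ Real.exp (x * T) * (3 * T * A * Real.exp (-x * T)) :=
            mul_le_mul_of_nonneg_left this (Real.exp_pos _).le
        _ = 3 * T * A * (Real.exp (x * T) * Real.exp (-x * T)) := by ring
        _ = _ := by rw [← Real.exp_add]; simp
  have hbdd : Bornology.IsBounded (range G) :=
    (Metric.isBounded_closedBall (x := (0 : ℂ)) (r := A * T)).subset (by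
      rintro _ ⟨z, rfl⟩
      rw [mem_closedBall_zero_iff]
      exact (le_total z.re 0).elim (hleft z) (hright z))
  have hconst : ∀ z, G z = G 0 := fun z => hGd.apply_eq_apply_of_bounded hbdd z 0
  have hint : ∀ x : ℝ, ∫ s in (0 : ℝ)..T, Real.exp (-x * s) * f s =
      Real.exp (-x * T) * ∫ s in (0 : ℝ)..T, f s := fun x => by
    have e := (hreal x).symm.trans ((hconst x).trans (by simpa using hreal 0))
    have e' : Real.exp (x * T) * ∫ s in (0 : ℝ)..T, Real.exp (-x * s) * f s =
      ∫ s in (0 : ℝ)..T, f s := by exact_mod_cast e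
    rw [← e', ← mul_assoc, ← Real.exp_add]
    simp
  have htot : ∫ s in (0 : ℝ)..T, f s = 0 := by
    have hb : ∀ x : ℝ, 0 < x → |∫ s in (0 : ℝ)..T, f s| ≤ A / x := fun x hx => by
      have e1 : ∫ s in (0 : ℝ)..T, f s = ∫ s in (0 : ℝ)..T, Real.exp (-x * (T - s)) * f s := by
        have := hint (-x)
        rw [neg_neg] at this
        have e2 : ∀ s, Real.exp (-x * (T - s)) * f s =
            Real.exp (-x * T) * (Real.exp (x * s) * f s) := fun s => by
          rw [← mul_assoc, ← Real.exp_add]; ring_nf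
        simp only [e2, intervalIntegral.integral_const_mul]
        rw [this, ← mul_assoc, ← Real.exp_add]
        simp
      rw [e1, ← Real.norm_eq_abs]
      have hd : ∀ s ∈ uIcc 0 T, HasDerivAt (fun s => A / x * Real.exp (-x * (T - s)))
          (Real.exp (-x * (T - s)) * A) s := fun s _ => by
        have : HasDerivAt (fun s : ℝ => -x * (T - s)) x s := by
          simpa using ((hasDerivAt_id s).const_sub T).const_mul (-x)
        convert! this.exp.const_mul (A / x) using 1
        field_simp
      have hci : IntervalIntegrable (fun s => Real.exp (-x * (T - s)) * A) volume 0 T :=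
        (by fun_prop : Continuous fun s => Real.exp (-x * (T - s)) * A).intervalIntegrable _ _
      refine (intervalIntegral.norm_integral_le_of_norm_le hT (Eventually.of_forall fun s hs => ?_)
        hci).trans ?_
      · rw [norm_mul, Real.norm_eq_abs, Real.abs_exp]
        exact mul_le_mul_of_nonneg_left (hA' s (Ioc_subset_Icc_self hs)) (Real.exp_pos _).le
      · rw [intervalIntegral.integral_eq_sub_of_hasDerivAt hd hci]
        simp only [sub_self, mul_zero, Real.exp_zero, mul_one]
        have : 0 ≤ A / x * Real.exp (-x * (T - 0)) := by positivity
        linarith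
    have hlim : Tendsto (fun x : ℝ => A / x) atTop (𝓝 0) := tendsto_const_nhds.div_atTop tendsto_id
    exact abs_nonpos_iff.1 (ge_of_tendsto hlim ((eventually_gt_atTop 0).mono hb))
  refine eq_zero_of_integral_exp_eq_zero hf hT (fun k => ?_) ht
  have := hint k
  rw [htot, mul_zero] at this
  refine Eq.trans (intervalIntegral.integral_congr fun s _ => ?_) this
  rw [← Real.exp_nat_mul, mul_comm (f s), mul_neg, neg_mul]

/-- Multiplication by the variable is a derivation for convolution, so p = f ∗ (sg) equals -(sf) ∗
g. Hence p ∗ p = -(f ∗ g) ∗ (sf ∗ sg) = 0, and the self-convolution case gives p = 0. -/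
theorem volterra_id_mul_eq_zero {f g : ℝ → ℝ} (hf : Continuous f) (hg : Continuous g)
    (h : ∀ t, 0 ≤ t → volterra f g t = 0) {t : ℝ} (ht : 0 ≤ t) :
    volterra f (fun s => s * g s) t = 0 := by
  have hg1 : Continuous fun s => s * g s := by fun_prop
  have hf1 : Continuous fun s => s * f s := by fun_prop
  set p := volterra f (fun s => s * g s)
  have hp : Continuous p := continuous_volterra hf hg1
  have hpp : ∀ t, 0 ≤ t → volterra p p t = 0 := fun t ht => by
    lift t to ℝ≥0 using ht with T
    have hF := fun s (hs : s ∈ Icc (0 : ℝ) T) => ext_ofFun (T := T) hf hs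
    have hG := fun s (hs : s ∈ Icc (0 : ℝ) T) => ext_ofFun (T := T) hg hs
    have hF1 := fun s (hs : s ∈ Icc (0 : ℝ) T) => ext_ofFun (T := T) hf1 hs
    have hG1 := fun s (hs : s ∈ Icc (0 : ℝ) T) => ext_ofFun (T := T) hg1 hs
    set F := ofFun T f hf
    set G := ofFun T g hg
    set F1 := ofFun T _ hf1
    set G1 := ofFun T _ hg1
    have e1 : F * G = 0 := eq_of_ext fun s hs => by
      rw [ext_mul_eq_volterra hF hG hs, h s hs.1, ext_zero]
    have e2 : F1 * G + F * G1 = 0 := eq_of_ext fun s hs => by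
      rw [ext_add, ext_mul_eq_volterra hF1 hG hs, ext_mul_eq_volterra hF hG1 hs, ext_zero, volterra,
        volterra, ← intervalIntegral.integral_add
          ((by fun_prop : Continuous fun r => (s - r) * f (s - r) * g r).intervalIntegrable _ _)
          ((by fun_prop : Continuous fun r => f (s - r) * (r * g r)).intervalIntegrable _ _)]
      have e3 : ∀ r, (s - r) * f (s - r) * g r + f (s - r) * (r * g r) =
          s * (f (s - r) * g r) := fun r => by ring
      simp only [e3, intervalIntegral.integral_const_mul]
      have := h s hs.1
      rw [volterra] at this
      rw [this, mul_zero]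
    have e4 : (F * G1) * (F * G1) = 0 := by
      have : F * G1 = -(F1 * G) := by rw [eq_neg_iff_add_eq_zero, add_comm, e2]
      conv_lhs => enter [1]; rw [this]
      rw [neg_mul, show F1 * G * (F * G1) = (F * G) * (F1 * G1) by
        simp only [mul_assoc, mul_left_comm], e1, zero_mul,
        neg_zero]
    have hP : ∀ s ∈ Icc (0 : ℝ) (T : ℝ≥0), (F * G1).ext s = p s := fun s hs =>
      ext_mul_eq_volterra hF hG1 hs
    exact (ext_mul_eq_volterra hP hP ⟨T.2, le_rfl⟩).symm.trans (by rw [e4, ext_zero])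
  have hpos : ∀ t, 0 < t → p t = 0 := fun t ht =>
    eq_zero_of_volterra_self hp (T := t + 1) (by linarith) (fun s hs => hpp s hs.1)
      ⟨ht, by linarith⟩
  rcases ht.eq_or_lt with rfl | ht
  · simp [p, volterra]
  · exact hpos t ht

/-- The ring of continuous functions on the half line under convolution has no zero divisors. -/
theorem volterra_eq_zero {f g : ℝ → ℝ} (hf : Continuous f) (hg : Continuous g)
    (h : ∀ t, 0 ≤ t → volterra f g t = 0) :
    (∀ t, 0 ≤ t → f t = 0) ∨ (∀ t, 0 ≤ t → g t = 0) := by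
  have hpow : ∀ n : ℕ, ∀ t, 0 ≤ t → volterra f (fun s => s ^ n * g s) t = 0 := fun n => by
    induction n with
    | zero => simpa using h
    | succ n ih =>
      intro t ht
      have := volterra_id_mul_eq_zero hf (by fun_prop : Continuous fun s => s ^ n * g s) ih ht
      simpa only [pow_succ', mul_assoc] using this
  -- For the fixed total time x + y, the function s ↦ f(x + y - s) g(s) has no polynomial moments,
  -- so it vanishes; evaluate it at s = y.
  have hprod : ∀ x y, 0 < x → 0 < y → f x * g y = 0 := fun x y hx hy => by
    have hc : Continuous fun s => f (x + y - s) * g s := by fun_prop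
    have h1 : ∀ᵐ s ∂(volume.restrict (Ioo (0 : ℝ) (x + y))), f (x + y - s) * g s = 0 := by
      refine ae_eq_zero_of_integral_continuous_mul (by positivity)
        ((hc.integrableOn_Icc (a := 0) (b := x + y)).mono_set Ioo_subset_Icc_self) fun ψ hψ => ?_
      refine integral_mul_eq_zero_of_polynomial (A := 0) (B := x + y) (by positivity)
        (hc.intervalIntegrable _ _) (θ := fun s => s) (χ := ψ) (by fun_prop) hψ hψ.continuousOn
        (fun s hs => hs) (fun s _ => rfl) fun k => ?_
      refine Eq.trans (intervalIntegral.integral_congr fun s _ => ?_) (hpow k (x + y) (by positivity))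
      ring
    have := Measure.eqOn_open_of_ae_eq (g := fun _ => (0 : ℝ)) h1 isOpen_Ioo hc.continuousOn
      continuousOn_const (x := y) ⟨hy, by linarith⟩
    simpa using this
  have hext : ∀ u : ℝ → ℝ, Continuous u → (∀ t, 0 < t → u t = 0) → ∀ t, 0 ≤ t → u t = 0 :=
    fun u hu h0 t ht => by
      have hcl : closure (Ioi (0 : ℝ)) ⊆ {t | u t = 0} :=
        closure_minimal h0 (isClosed_eq hu continuous_const)
      rw [closure_Ioi] at hcl
      exact hcl ht
  by_cases hf0 : ∀ t, 0 < t → f t = 0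
  · exact Or.inl (hext f hf hf0)
  · push Not at hf0
    obtain ⟨x, hx, hfx⟩ := hf0
    exact Or.inr (hext g hg fun y hy => (mul_eq_zero.1 (hprod x y hx hy)).resolve_left hfx)

/-! ### Recovery of the relaxation kernel -/

namespace GurtinPipkin

theorem eq_of_volterra_primitive_eq {a b g : ℝ → ℝ} (ha : ContinuousOn a (Ici 0))
    (hb : ContinuousOn b (Ici 0)) (hg : ContinuousOn g (Ici 0)) (hg0 : ∃ r, 0 ≤ r ∧ g r ≠ 0)
    (h : ∀ t, 0 ≤ t → volterra a (primitive g) t = volterra b (primitive g) t) {t : ℝ}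
    (ht : 0 ≤ t) : b t = a t := by
  have ext_cont : ∀ {u : ℝ → ℝ}, ContinuousOn u (Ici 0) → Continuous fun t => u (max t 0) :=
    fun hu => hu.comp_continuous (by fun_prop) fun t => le_max_right t 0
  have hF := primitive_continuousOn hg
  have hF' := ext_cont hF
  have hg' := ext_cont hg
  have hd : ContinuousOn (fun t => b t - a t) (Ici 0) := hb.sub ha
  have hzero : ∀ t, 0 ≤ t →
      volterra (fun t => b (max t 0) - a (max t 0)) (fun t => primitive g (max t 0)) t = 0 :=
    fun t ht => by
      rw [volterra_congr (f' := fun t => b t - a t) (g' := primitive g) ht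
        (fun s hs => by simp [hs.1]) (fun s hs => by simp [hs.1]), volterra]
      simp only [sub_mul]
      rw [intervalIntegral.integral_sub (intervalIntegrable_volterra hb hF ht)
        (intervalIntegrable_volterra ha hF ht)]
      exact sub_eq_zero.2 (h t ht).symm
  rcases volterra_eq_zero (ext_cont hd) hF' hzero with h1 | h1
  · have := h1 t ht
    rwa [max_eq_left ht, sub_eq_zero] at this
  · exfalso
    obtain ⟨r, hr, hgr⟩ := hg0
    have hder : HasDerivAt (fun t => ∫ s in (0 : ℝ)..t, g (max s 0)) (g (max r 0)) r :=
      intervalIntegral.integral_hasDerivAt_right (hg'.intervalIntegrable _ _)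
        (hg'.stronglyMeasurableAtFilter _ _) hg'.continuousAt
    have hz : ∀ t ∈ Ici (0 : ℝ), ∫ s in (0 : ℝ)..t, g (max s 0) = 0 := fun t ht => by
      have h2 := h1 t ht
      rw [max_eq_left ht, primitive] at h2
      refine Eq.trans (intervalIntegral.integral_congr fun s hs => ?_) h2
      rw [uIcc_of_le ht] at hs
      simp [hs.1]
    -- The primitive is known to vanish only on the half line, so derivatives are compared within
    -- it; this covers r = 0.
    have hder0 : HasDerivWithinAt (fun t => ∫ s in (0 : ℝ)..t, g (max s 0)) 0 (Ici 0) r :=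
      (hasDerivWithinAt_const r (Ici 0) (0 : ℝ)).congr_of_mem hz hr
    have := (uniqueDiffOn_Ici (0 : ℝ) r hr).eq_deriv _ hder.hasDerivWithinAt hder0
    rw [max_eq_left hr] at this
    exact hgr this

end GurtinPipkin

end

theorem mainTheorem2 (L : ℝ) (hL : 0 < L) (a β g : ℝ → ℝ)
    (ha : ContDiffOn ℝ 2 a (Ici 0)) (hβ : ContDiffOn ℝ 2 β (Ici 0)) (ha0 : 0 < a 0)
    (hg : ContinuousOn g (Ici 0))
    (ξ : GurtinPipkin.L2 L)
    (hξ : ∀ n : ℕ, 1 ≤ n →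
      GurtinPipkin.pairing L ξ (GurtinPipkin.eigenfun L n) = 1 / GurtinPipkin.freq L n)
    (θξ θf : ℝ → GurtinPipkin.L2 L)
    (hθξ : GurtinPipkin.IsSolution L a β (fun _ => 0) ξ θξ)
    (hθf : GurtinPipkin.IsSolution L a β (GurtinPipkin.primitive g) 0 θf) :
    ∃ K Y : ℝ → ℝ,
      (∀ t : ℝ, 0 ≤ t → ∀ y : ℝ, GurtinPipkin.IsFluxAtRight L a θξ t y ↔ y = K t) ∧
      (∀ t : ℝ, 0 ≤ t → ∀ y : ℝ, GurtinPipkin.IsFluxAtRight L a θf t y ↔ y = Y t) ∧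
      (∀ t : ℝ, 0 ≤ t → IntervalIntegrable K volume 0 t) ∧
      (∀ t : ℝ, 0 ≤ t → Y t = GurtinPipkin.fluxFormula L β g K a t) ∧
      ((∃ r : ℝ, 0 ≤ r ∧ g r ≠ 0) →
        ∀ b : ℝ → ℝ, ContinuousOn b (Ici 0) →
          (∀ t : ℝ, 0 ≤ t → Y t = GurtinPipkin.fluxFormula L β g K b t) →
          ∀ t : ℝ, 0 ≤ t → b t = a t) := by
  -- K is chosen on the whole line; its values at negative times are irrelevant.
  have hex : ∀ t : ℝ, ∃ y, 0 ≤ t → GurtinPipkin.IsFluxAtRight L a θξ t y := fun t => by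
    rcases lt_or_ge t 0 with h | h
    · exact ⟨0, fun h' => absurd h' (not_le.2 h)⟩
    obtain ⟨q, -, -, -, hql, -, -, hqf⟩ :=
      GurtinPipkin.exists_interior_profile hL ha hβ ha0 hξ hθξ ⟨t, h⟩
    obtain ⟨y, hy⟩ := hql t
    exact ⟨y, fun _ => hqf t ⟨h, le_rfl⟩ y hy⟩
  choose K hK using hex
  have hKiff : ∀ t : ℝ, 0 ≤ t → ∀ y, GurtinPipkin.IsFluxAtRight L a θξ t y ↔ y = K t :=
    fun t ht y => ⟨fun h => h.unique hL (hK t ht), fun h => h ▸ hK t ht⟩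
  have hmain := fun t (ht : 0 ≤ t) =>
    GurtinPipkin.isFluxAtRight_boundary hL ha hβ ha0 hg hξ hθξ hθf hKiff ht
  refine ⟨K, GurtinPipkin.fluxFormula L β g K a, hKiff,
    fun t ht y => ⟨fun h => h.unique hL (hmain t ht).2, fun h => h ▸ (hmain t ht).2⟩,
    fun t ht => (hmain t ht).1, fun _ _ => rfl, fun hg0 b hb hY t ht => ?_⟩
  refine GurtinPipkin.eq_of_volterra_primitive_eq ha.continuousOn hb hg hg0 (fun t ht => ?_) ht
  have hγ := GurtinPipkin.gamma0_pos hL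
  have := hY t ht
  rw [GurtinPipkin.fluxFormula_eq, GurtinPipkin.fluxFormula_eq] at this
  have h1 := mul_left_cancel₀ hγ.ne' this
  exact mul_left_cancel₀ (half_pos hγ).ne' (sub_left_injective h1)
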